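/- Let $(\mathcal O,\mathfrak m,K)$ be a regular local ring of dimension $2$, essentially of finite type over a field $k$, and let $0\neq f\in\mathfrak m$ be such that the reduction of $\mathcal O/(f)$ is not regular. Let $\nu=\max\{n : f\in\mathfrak m^n\}$. For a regular system of parameters $(y,x)$ of $\mathcal O$, expand $f=\sum_{(A,b)}c_{A,b}\,x^Ay^b$ (a finite sum with $c_{A,b}\in\mathcal O^\times\cup\{0\}$) and put $$\Delta(f;x;y)=\operatorname{conv}\Big(\bigcup_{c_{A,b}\ne 0,\ b<\nu}\Big(\tfrac{A}{\nu-b}+\mathbb R_{\ge 0}\Big)\Big)\subseteq\mathbb R .$$ This set does not depend on the expansion. Let $\Delta(f;x)=\bigcap_y\Delta(f;x;y)$, the intersection over all $y$ such that $(y,x)$ is a regular system of parameters. Let $(x_1,x_2)$ be a regular system of parameters of $\mathcal O$ and let $\delta\in\mathbb Q$ be such that one of the following holds. * There are a $y$ such that $(y,x_2)$ is a regular system of parameters and a unit $u$ with $f\equiv u\,y^\nu \bmod \mathfrak m^{\nu+1}$, and $\Delta(f;x_2;x_1)=\Delta(f;x_2)=[\delta,\infty)$. * The initial form of $f$ in $\operatorname{gr}_{\mathfrak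 m}(\mathcal O)$ is not a nonzero constant times the $\nu$-th power of a linear form, and $\delta=1$. For a regular system of parameters $(y_1,y_2)$ and positive rational numbers $b_1,b_2$, the center $J=(y_1^{b_1},y_2^{b_2})$ is the monomial valuation $v_J$ with $v_J(y_i)=1/b_i$; that is, $v_J(g)$ is the largest $t$ such that $g$ lies in the ideal generated by the monomials $y_1^iy_2^j$ with $i/b_1+j/b_2\ge t$. Two centers are equal if their valuations are. The center $J$ is admissible for $f$ if $v_J(f)\ge 1$. Put $(a_1,a_2)=(\nu,\nu\delta)$. Then: 1. $a_1\le a_2$, the center $J=(x_1^{a_1},x_2^{a_2})$ is admissible for $f$, every admissible center $(y_1^{b_1},y_2^{b_2})$ with $b_1\le b_2$ satisfies $(b_1,b_2)\le_{\mathrm{lex}}(a_1,a_2)$, and if $(b_1,b_2)=(a_1,a_2)$ then $(y_1^{b_1},y_2^{b_2})=J$. 2. $J$ is stable under base change to separable field extensions of $k$. That is, let $k'/k$ be a separable (not necessarily algebraic) field extension, let $P$ be a minimal prime over $\mathfrak m(\mathcal O\otimes_kk')$ (a generic point of the fibre over the closed point; if $k'/k$ is algebraic, every prime lying over $\mathfrak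 m$ is one), and let $\mathcal O'=(\mathcal O\otimes_kk')_P$. Then $\mathcal O'$ is a regular local ring of dimension $2$, the images of $(x_1,x_2)$ form a regular system of parameters of $\mathcal O'$, and the center $(x_1^{a_1},x_2^{a_2})$ of $\mathcal O'$ has the properties in part 1 with respect to the image of $f$ in $\mathcal O'$. -/

import Mathlib

open IsLocalRing
open scoped TensorProduct

universe u v

namespace PlaneCurve

section LocalRing

variable {O : Type u} [CommRing O]

/-- `(x₁, x₂)` is a regular system of parameters of the two-dimensional regular local ring `O`. -/
structure IsParameters [IsLocalRing O] (x₁ x₂ : O) : Prop where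
  isRegularLocalRing : IsRegularLocalRing O
  ringKrullDim_eq : ringKrullDim O = 2
  span_eq : Ideal.span {x₁, x₂} = maximalIdeal O

/-- The order `ν` of `f` at the maximal ideal: the largest `n` with `f ∈ 𝔪 ^ n`
(meaningful for `f ≠ 0`). -/
noncomputable def order [IsLocalRing O] (f : O) : ℕ :=
  sSup {n : ℕ | f ∈ maximalIdeal O ^ n}

/-- The initial form of `f` is a nonzero constant times the `ν`-th power of the class of `y`:
`f ≡ u * y ^ ν` modulo `𝔪 ^ (ν + 1)` for some unit `u`. (The unit is there because `f` matters
only up to units, being a local equation of a curve.) -/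
def HasInitialPower [IsLocalRing O] (f y : O) : Prop :=
  ∃ u : O, IsUnit u ∧ f - u * y ^ order f ∈ maximalIdeal O ^ (order f + 1)

/-- `c` is a finite expansion `f = ∑ c (A, b) * x ^ A * y ^ b` whose coefficients are units
or zero. -/
def IsExpansion (f x y : O) (c : ℕ × ℕ →₀ O) : Prop :=
  (∀ p ∈ c.support, IsUnit (c p)) ∧ f = c.sum fun p a => a * (x ^ p.1 * y ^ p.2)

/-- The projected polyhedron `Δ(f; x; y)`, a subset of the real line: the convex hull of the sets
`A / (ν - b) + ℝ_{≥ 0}` for the monomials `x ^ A * y ^ b` with `b < ν` that occur in an expansion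
of `f` with coefficients that are units or zero. It does not depend on the expansion: if
`x` and `y` generate the maximal ideal of a two-dimensional regular local ring, all such
expansions of `f` have the same least value of `A / (ν - b)`. -/
def projectedPolyhedron [IsLocalRing O] (f x y : O) : Set ℝ :=
  convexHull ℝ {r | ∃ c, IsExpansion f x y c ∧ ∃ p ∈ c.support, p.2 < order f ∧
    ∃ s : ℝ, 0 ≤ s ∧ r = (p.1 : ℝ) / ((order f : ℝ) - (p.2 : ℝ)) + s}

/-- The characteristic polyhedron `Δ(f; x)`: the intersection of the projected polyhedra
`Δ(f; x; y)` over all `y` which complete `x` to a regular system of parameters. -/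
def characteristicPolyhedron [IsLocalRing O] (f x : O) : Set ℝ :=
  ⋂ (y : O) (_ : IsParameters y x), projectedPolyhedron f x y

/-- The parameters `(x₁, x₂)` realize the characteristic polyhedron `[δ, ∞)` of `f`.

If the initial form of `f` is a constant times a power of a linear form, `x₂` has to be
complementary to that linear form and `Δ(f; x₂; x₁) = Δ(f; x₂) = [δ, ∞)`. If the initial form
of `f` is not of this kind, the convention is `δ = 1`, with arbitrary parameters. -/
def RealizesCharacteristicPolyhedron [IsLocalRing O] (f x₁ x₂ : O) (δ : ℚ) : Prop :=
  IsParameters x₁ x₂ ∧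
    (((∃ y : O, IsParameters y x₂ ∧ HasInitialPower f y) ∧
        projectedPolyhedron f x₂ x₁ = characteristicPolyhedron f x₂ ∧
        characteristicPolyhedron f x₂ = Set.Ici (δ : ℝ)) ∨
      ((¬ ∃ y₁ y₂ : O, IsParameters y₁ y₂ ∧ HasInitialPower f y₁) ∧ δ = 1))

end LocalRing

/-- The data of a center `J = (x₁ ^ a₁, x₂ ^ a₂)`: parameters and positive rational exponents.
The center itself is the monomial valuation `Center.val`; two sets of data give the same center
when these valuations agree. -/
structure Center (O : Type u) [CommRing O] [IsLocalRing O] where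
  x₁ : O
  x₂ : O
  a₁ : ℚ
  a₂ : ℚ
  isParameters : IsParameters x₁ x₂
  a₁_pos : 0 < a₁
  a₂_pos : 0 < a₂

namespace Center

variable {O : Type u} [CommRing O] [IsLocalRing O]

/-- The ideal generated by the monomials `x₁ ^ i * x₂ ^ j` of weight `i / a₁ + j / a₂ ≥ t`. -/
def weightIdeal (J : Center O) (t : ℝ) : Ideal O :=
  Ideal.span {m | ∃ i j : ℕ, t ≤ (i : ℝ) / (J.a₁ : ℝ) + (j : ℝ) / (J.a₂ : ℝ) ∧
    m = J.x₁ ^ i * J.x₂ ^ j}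

/-- The monomial valuation `v_J` with `v_J x₁ = 1 / a₁` and `v_J x₂ = 1 / a₂`: the largest `t`
such that `g` lies in the ideal generated by the monomials of weight at least `t`
(and `⊤` for `g = 0`). -/
noncomputable def val (J : Center O) (g : O) : EReal :=
  sSup (Real.toEReal '' {t : ℝ | g ∈ J.weightIdeal t})

/-- `J` is admissible for `f` if `v_J f ≥ 1`. -/
def IsAdmissible (J : Center O) (f : O) : Prop :=
  1 ≤ J.val f

/-- The invariant `(a₁, a₂)` of `J`, with the lexicographic order on pairs of rationals. -/
def inv (J : Center O) : ℚ ×ₗ ℚ :=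
  toLex (J.a₁, J.a₂)

/-- `J` is the unique center, among the centers `(y₁ ^ b₁, y₂ ^ b₂)` with `b₁ ≤ b₂` that are
admissible for `f`, for which the invariant is lexicographically maximal. -/
def IsUniqueMaximalAdmissible (J : Center O) (f : O) : Prop :=
  J.a₁ ≤ J.a₂ ∧ J.IsAdmissible f ∧
    ∀ J' : Center O, J'.a₁ ≤ J'.a₂ → J'.IsAdmissible f →
      J'.inv ≤ J.inv ∧ (J'.inv = J.inv → J'.val = J.val)

end Center

/-- A field extension `k'` of `k`, algebraic or not, is separable: `L ⊗ k'` is reduced for every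
field extension `L` of `k`. (For algebraic extensions this means that all elements of `k'` have
separable minimal polynomials; the extensions `L` in the universe of `k` suffice, since they
include an algebraic closure of `k`.) -/
def IsSeparableExtension (k : Type u) (k' : Type v) [Field k] [Field k'] [Algebra k k'] : Prop :=
  ∀ (L : Type u) [Field L] [Algebra k L], IsReduced (L ⊗[k] k')

end PlaneCurve

/-! Give `x₁` weight `δ` and `x₂` weight `1`, and let `n` be the order of `f`. Everything follows
from `IsMaximalWeight`: `f` has weight at least `δ * n`, and for no parameters `(y, z)` is `f` a
multiple of `y ^ n` up to terms of larger weight. The polyhedron yields this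
(`RealizesCharacteristicPolyhedron.isMaximalWeight`): a form `y ^ n` would push some projected
polyhedron strictly to the right of `δ`.

Maximality: `b₁ > n` would put `f` in `𝔪 ^ (n + 1)`, while `b₁ = n`, `b₂ > n * δ` would make the
initial form a power of `y₁`. For uniqueness, `IsParameters.mem_span_of_mem_weightGe` shows that two
optimal centers have first parameters of weight at least `δ` with respect to each other, so the
weight filtrations coincide.

Base change: suppose that over `k'` the initial form is `u * (x₁ + β * x₂ ^ N) ^ n`. Only integral
`δ = N` matters, since otherwise `x₂ ^ N` is too heavy. If `q` is the largest power of the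
characteristic exponent dividing `n` (`q = 1` in characteristic zero), the coefficient of `x₁ ^ (n -
q)` shows that `β ^ q` lies in the old residue field. Separability forces `β` into it, and faithful
flatness brings the `n`-th power down to `O`, a contradiction (`IsMaximalWeight.map`). -/

namespace PlaneCurve

/-! ### Two-dimensional regular local rings: parameters are prime, the ring is a domain. -/

section RegularSequence

variable {R : Type u} [CommRing R] [IsLocalRing R] {x y : R}

namespace IsParameters

theorem mem_left (h : IsParameters x y) : x ∈ maximalIdeal R :=
  h.span_eq ▸ Ideal.subset_span (by simp)

theorem mem_right (h : IsParameters x y) : y ∈ maximalIdeal R :=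
  h.span_eq ▸ Ideal.subset_span (by simp)

theorem isNoetherianRing (h : IsParameters x y) : IsNoetherianRing R :=
  have := h.isRegularLocalRing
  inferInstance

theorem symm (h : IsParameters x y) : IsParameters y x :=
  ⟨h.isRegularLocalRing, h.ringKrullDim_eq, by rw [Set.pair_comm, h.span_eq]⟩

theorem exists_eq_add (h : IsParameters x y) {z : R} (hz : z ∈ maximalIdeal R) :
    ∃ a b, z = a * x + b * y := by
  rw [← h.span_eq, Ideal.mem_span_pair] at hz
  obtain ⟨a, b, hab⟩ := hz
  exact ⟨a, b, hab.symm⟩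

theorem of_mem (h : IsParameters x y) {z w : R} (hz : z ∈ maximalIdeal R)
    (hw : w ∈ maximalIdeal R) (hx : x ∈ Ideal.span {z, w}) (hy : y ∈ Ideal.span {z, w}) :
    IsParameters z w := by
  refine ⟨h.isRegularLocalRing, h.ringKrullDim_eq, le_antisymm ?_ ?_⟩
  · rw [Ideal.span_le]
    rintro _ (rfl | rfl)
    exacts [hz, hw]
  · rw [← h.span_eq, Ideal.span_le]
    rintro _ (rfl | rfl)
    exacts [hx, hy]

theorem maximalIdeal_height (h : IsParameters x y) : (maximalIdeal R).height = 2 := by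
  have := IsLocalRing.maximalIdeal_height_eq_ringKrullDim (R := R)
  rw [h.ringKrullDim_eq] at this
  exact WithBot.coe_injective this

/-- Otherwise the maximal ideal, of height two, would be minimal over a principal ideal, against
Krull's height theorem. -/
theorem pow_not_mem (h : IsParameters x y) (n : ℕ) : y ^ n ∉ Ideal.span {x} := by
  intro hn
  have := h.isNoetherianRing
  have hmin : maximalIdeal R ∈ (Ideal.span {x}).minimalPrimes := by
    refine ⟨⟨inferInstance, ?_⟩, ?_⟩
    · simpa [Ideal.span_le] using h.mem_left
    · rintro q ⟨hq, hxq⟩ -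
      rw [← h.span_eq, Ideal.span_le]
      rintro _ (rfl | rfl)
      · exact hxq (Ideal.subset_span rfl)
      · exact hq.mem_of_pow_mem n (hxq hn)
  have := Ideal.height_le_one_of_isPrincipal_of_mem_minimalPrimes (Ideal.span {x}) _ hmin
  rw [h.maximalIdeal_height] at this
  exact absurd this (by decide)

theorem mem_span_of_forall (h : IsParameters x y) {z : R}
    (hz : ∀ n, z ∈ Ideal.span {x, y ^ n}) : z ∈ Ideal.span {x} := by
  have := h.isNoetherianRing
  have key := Ideal.iInf_pow_smul_eq_bot_of_isLocalRing (M := R ⧸ Ideal.span {x})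
    (maximalIdeal R) Ideal.IsPrime.ne_top'
  rw [← Ideal.Quotient.eq_zero_iff_mem]
  change _ ∈ (⊥ : Submodule R (R ⧸ Ideal.span {x}))
  rw [← key, Submodule.mem_iInf]
  intro n
  obtain ⟨a, b, hab⟩ := Ideal.mem_span_pair.1 (hz n)
  have : Ideal.Quotient.mk (Ideal.span {x}) z = y ^ n • Ideal.Quotient.mk (Ideal.span {x}) b := by
    rw [← Ideal.Quotient.mk_eq_mk, ← Ideal.Quotient.mk_eq_mk, ← Submodule.Quotient.mk_smul,
      Submodule.Quotient.eq, Ideal.mem_span_singleton]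
    exact ⟨a, by rw [← hab, smul_eq_mul]; ring⟩
  rw [this]
  exact Submodule.smul_mem_smul (Ideal.pow_mem_pow h.mem_right n) trivial

/-- In the quotient by `x` every nonzero element is a unit times a power of `y`: by Krull's
intersection theorem there is a last `n` with `z ∈ (x, y ^ n)`. -/
theorem exists_isUnit (h : IsParameters x y) {z : R} (hz : z ∉ Ideal.span {x}) :
    ∃ a u n, IsUnit u ∧ z = a * x + u * y ^ n := by
  classical
  have hex : ∃ n, z ∉ Ideal.span {x, y ^ n} := by
    by_contra! hcon
    exact hz (h.mem_span_of_forall hcon)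
  set n := Nat.find hex with hn
  have hn0 : n ≠ 0 := by
    intro h0
    have := Nat.find_spec hex
    rw [← hn, h0, pow_zero, (Ideal.eq_top_iff_one _).2 (Ideal.subset_span (by simp))] at this
    exact this trivial
  obtain ⟨m, hm⟩ := Nat.exists_eq_succ_of_ne_zero hn0
  have hzm : z ∈ Ideal.span {x, y ^ m} := by
    by_contra hcon
    exact Nat.find_min hex (m := m) (by omega) hcon
  obtain ⟨a, u, hau⟩ := Ideal.mem_span_pair.1 hzm
  refine ⟨a, u, m, ?_, hau.symm⟩
  by_contra hu
  obtain ⟨b, c, hbc⟩ := h.exists_eq_add ((mem_maximalIdeal u).2 hu)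
  refine Nat.find_spec hex ?_
  rw [← hn, hm]
  refine Ideal.mem_span_pair.2 ⟨a + b * y ^ m, c, ?_⟩
  rw [← hau, hbc, pow_succ]
  ring

theorem isPrime_span (h : IsParameters x y) : (Ideal.span {x}).IsPrime := by
  refine ⟨?_, ?_⟩
  · intro htop
    exact h.pow_not_mem 1 (htop ▸ trivial)
  · intro a b hab
    by_contra! hcon
    obtain ⟨a', u, n, hu, rfl⟩ := h.exists_isUnit hcon.1
    obtain ⟨b', w, m, hw, rfl⟩ := h.exists_isUnit hcon.2
    apply h.pow_not_mem (n + m)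
    rw [Ideal.mem_span_singleton] at hab ⊢
    obtain ⟨c, hc⟩ := hab
    rw [← (hu.mul hw).dvd_mul_left]
    refine ⟨c - a' * (b' * x + w * y ^ m) - u * y ^ n * b', ?_⟩
    rw [pow_add]
    linear_combination hc

theorem add_pow (h : IsParameters x y) {n : ℕ} (hn : n ≠ 0) : IsParameters (x + y ^ n) y := by
  refine h.of_mem (add_mem h.mem_left (Ideal.pow_mem_of_mem _ h.mem_right _ (by omega)))
    h.mem_right ?_ (Ideal.subset_span (by simp))
  refine Ideal.mem_span_pair.2 ⟨1, -y ^ (n - 1), ?_⟩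
  have : y ^ n = y ^ (n - 1) * y := by rw [← pow_succ]; congr; omega
  rw [this]
  ring

theorem not_mem_minimalPrime (h : IsParameters x y) {p : Ideal R} [p.IsPrime]
    (hp : p ∈ minimalPrimes R) : p ≠ maximalIdeal R := by
  rintro rfl
  have := (Ideal.height_eq_zero_iff (I := maximalIdeal R)).2 hp
  rw [h.maximalIdeal_height] at this
  exact absurd this (by decide)

/-- Pigeonhole on the finitely many minimal primes: if `x + y ^ n` and `x + y ^ m` lie in the same
one, so does `y ^ n * (1 - y ^ (m - n))`, hence `y` and `x`, and that prime is the maximal ideal. -/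
theorem exists_add_pow_not_mem (h : IsParameters x y) :
    ∃ n, n ≠ 0 ∧ ∀ p ∈ minimalPrimes R, x + y ^ n ∉ p := by
  have := h.isNoetherianRing
  by_contra! hcon
  have hfin : (minimalPrimes R).Finite := minimalPrimes.finite_of_isNoetherianRing R
  choose! p hp hxp using hcon
  have hmaps : Set.MapsTo p (Set.Ioi 0) (minimalPrimes R) := fun n hn => hp n (ne_of_gt hn)
  obtain ⟨n, hn, m, hm, hnm, heq⟩ :=
    (Set.Ioi_infinite 0).exists_lt_map_eq_of_mapsTo hmaps hfin
  have hn' := hxp n (ne_of_gt hn)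
  have hm' := hxp m (ne_of_gt hm)
  rw [← heq] at hm'
  have hprime : (p n).IsPrime := (hp n (ne_of_gt hn)).1.1
  have hy : y ∈ p n := by
    have h1 : y ^ n * (1 - y ^ (m - n)) ∈ p n := by
      have : y ^ n * (1 - y ^ (m - n)) = (x + y ^ n) - (x + y ^ m) := by
        rw [mul_sub, ← pow_add, Nat.add_sub_cancel' hnm.le]
        ring
      rw [this]
      exact sub_mem hn' hm'
    rcases hprime.mem_or_mem h1 with h2 | h2
    · exact hprime.mem_of_pow_mem n h2
    · exfalso
      refine hprime.ne_top (Ideal.eq_top_of_isUnit_mem _ h2 ?_)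
      have hmem : y ^ (m - n) ∈ maximalIdeal R :=
        Ideal.pow_mem_of_mem _ h.mem_right _ (by omega)
      by_contra hu
      have h3 := add_mem ((mem_maximalIdeal _).2 hu) hmem
      rw [sub_add_cancel] at h3
      exact (Ideal.ne_top_iff_one _).1 Ideal.IsPrime.ne_top' h3
  have hx : x ∈ p n := by
    have := sub_mem hn' (Ideal.pow_mem_of_mem _ hy n hn)
    rwa [add_sub_cancel_right] at this
  refine h.not_mem_minimalPrime (hp n (ne_of_gt hn))
    ((IsLocalRing.maximalIdeal.isMaximal R).eq_of_le hprime.ne_top ?_).symm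
  rw [← h.span_eq, Ideal.span_le]
  rintro _ (rfl | rfl)
  exacts [hx, hy]

/-- Take a parameter `z` outside all minimal primes and a minimal prime `p` inside the prime `(z)`.
An element `z * b` of `p` has `b ∈ p`, so `p ≤ 𝔪 p`, and `p = 0` by Nakayama. -/
theorem isDomain (h : IsParameters x y) : IsDomain R := by
  have := h.isNoetherianRing
  obtain ⟨n, hn, hmin⟩ := h.exists_add_pow_not_mem
  set z := x + y ^ n with hz
  have hzy : IsParameters z y := h.add_pow hn
  have := hzy.isPrime_span
  obtain ⟨p, hp, hple⟩ := Ideal.exists_minimalPrimes_le (bot_le : (⊥ : Ideal R) ≤ Ideal.span {z})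
  have hprime : p.IsPrime := hp.1.1
  have hbot : p = ⊥ := by
    refine Submodule.eq_bot_of_le_smul_of_le_jacobson_bot (maximalIdeal R) p
      (IsNoetherian.noetherian p) ?_ (IsLocalRing.maximalIdeal_le_jacobson _)
    intro a ha
    obtain ⟨b, rfl⟩ := Ideal.mem_span_singleton.1 (hple ha)
    have hb := (hprime.mem_or_mem ha).resolve_left (hmin p hp)
    exact Submodule.smul_mem_smul hzy.mem_left hb
  rw [hbot] at hprime
  exact IsDomain.of_bot_isPrime R

theorem not_dvd (h : IsParameters x y) : ¬ x ∣ y := fun hd =>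
  h.pow_not_mem 1 (by rwa [pow_one, Ideal.mem_span_singleton])

theorem left_ne_zero (h : IsParameters x y) : x ≠ 0 := by
  rintro rfl
  exact h.symm.not_dvd (dvd_zero _)

theorem prime_left (h : IsParameters x y) : Prime x :=
  (Ideal.span_singleton_prime h.left_ne_zero).1 h.isPrime_span

/-- The tool for comparing coefficients: since `x` and `y` are non-associated primes of a domain,
the monomial can be cancelled, leaving `a ∈ (x, y)`. -/
theorem coeff_mem (h : IsParameters x y) {a : R} {m n : ℕ}
    (ha : a * (x ^ m * y ^ n) ∈ Ideal.span {x ^ (m + 1), y ^ (n + 1)}) :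
    a ∈ maximalIdeal R := by
  have := h.isDomain
  obtain ⟨u, v, huv⟩ := Ideal.mem_span_pair.1 ha
  have hx := h.prime_left
  have hy := h.symm.prime_left
  have h1 : x ^ m ∣ v := by
    refine hx.pow_dvd_of_dvd_mul_right m (b := y ^ (n + 1)) ?_ ?_
    · exact fun hd => h.not_dvd (hx.dvd_of_dvd_pow hd)
    · exact ⟨a * y ^ n - u * x, by linear_combination huv⟩
  obtain ⟨w, rfl⟩ := h1
  have h2 : a * y ^ n = u * x + w * y ^ (n + 1) := by
    refine mul_left_cancel₀ (pow_ne_zero m hx.ne_zero) ?_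
    linear_combination -huv
  have h3 : y ^ n ∣ u := by
    refine hy.pow_dvd_of_dvd_mul_right n h.symm.not_dvd ?_
    exact ⟨a - w * y, by linear_combination -h2⟩
  obtain ⟨t, rfl⟩ := h3
  have h4 : a = t * x + w * y := by
    refine mul_left_cancel₀ (pow_ne_zero n hy.ne_zero) ?_
    linear_combination h2
  rw [h4]
  exact add_mem (Ideal.mul_mem_left _ _ h.mem_left) (Ideal.mul_mem_left _ _ h.mem_right)

end IsParameters

end RegularSequence

/-! ### Monomial ideals and the exponents of expansions. -/

section MonomialIdeal

variable {R : Type u} [CommRing R]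

/-- The ideal generated by the monomials `x ^ i * y ^ j` with exponents `(i, j) ∈ G`. -/
def monomialIdeal (x y : R) (G : Set (ℕ × ℕ)) : Ideal R :=
  Ideal.span ((fun p : ℕ × ℕ => x ^ p.1 * y ^ p.2) '' G)

theorem monomial_mem {x y : R} {G : Set (ℕ × ℕ)} {i j : ℕ} (h : (i, j) ∈ G) :
    x ^ i * y ^ j ∈ monomialIdeal x y G :=
  Ideal.subset_span ⟨(i, j), h, rfl⟩

theorem monomialIdeal_le {x y : R} {G : Set (ℕ × ℕ)} {I : Ideal R} :
    monomialIdeal x y G ≤ I ↔ ∀ i j, (i, j) ∈ G → x ^ i * y ^ j ∈ I := by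
  rw [monomialIdeal, Ideal.span_le]
  constructor
  · exact fun h i j hij => h ⟨(i, j), hij, rfl⟩
  · rintro h _ ⟨⟨i, j⟩, hij, rfl⟩
    exact h i j hij

theorem monomialIdeal_mono {x y : R} {G H : Set (ℕ × ℕ)} (h : G ⊆ H) :
    monomialIdeal x y G ≤ monomialIdeal x y H :=
  Ideal.span_mono (Set.image_mono h)

theorem map_monomialIdeal {S : Type v} [CommRing S] (φ : R →+* S) (x y : R) (G : Set (ℕ × ℕ)) :
    (monomialIdeal x y G).map φ = monomialIdeal (φ x) (φ y) G := by
  rw [monomialIdeal, monomialIdeal, Ideal.map_span, Set.image_image]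
  simp

theorem monomialIdeal_le_span {x y : R} {G : Set (ℕ × ℕ)} {m n : ℕ}
    (h : ∀ i j, (i, j) ∈ G → m < i ∨ n < j) :
    monomialIdeal x y G ≤ Ideal.span {x ^ (m + 1), y ^ (n + 1)} := by
  rw [monomialIdeal_le]
  intro i j hij
  rcases h i j hij with h | h
  · exact Ideal.mul_mem_right _ _ (Ideal.mem_of_dvd _ (pow_dvd_pow x h)
      (Ideal.subset_span (by simp)))
  · exact Ideal.mul_mem_left _ _ (Ideal.mem_of_dvd _ (pow_dvd_pow y h)
      (Ideal.subset_span (by simp)))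

theorem IsParameters.coeff_mem_of_mem_monomialIdeal [IsLocalRing R] {x y : R}
    (h : IsParameters x y) {a : R} {m n : ℕ} {G : Set (ℕ × ℕ)}
    (hG : ∀ i j, (i, j) ∈ G → m < i ∨ n < j) (ha : a * (x ^ m * y ^ n) ∈ monomialIdeal x y G) :
    a ∈ maximalIdeal R :=
  h.coeff_mem (monomialIdeal_le_span hG ha)

/-- If `f` lies in a monomial ideal, then every exponent that occurs in an expansion of `f`
dominates the exponent of a generator. -/
theorem IsExpansion.exists_le [IsLocalRing R] {x y f : R} (h : IsParameters x y)
    {c : ℕ × ℕ →₀ R} (hc : IsExpansion f x y c) {G : Set (ℕ × ℕ)}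
    (hf : f ∈ monomialIdeal x y G) (p : ℕ × ℕ) (hp : p ∈ c.support) :
    ∃ g ∈ G, g ≤ p := by
  classical
  induction hn : p.1 + p.2 using Nat.strong_induction_on generalizing p with
  | _ N ih =>
  by_contra! hcon
  subst hn
  -- By induction on total degree no other exponent of `c` lies below `p`, as the generator below it
  -- would also lie below `p`. So the term at `p` can be isolated modulo `(x ^ (p.1 + 1), y ^ (p.2 +
  -- 1))`.
  have hq : ∀ q ∈ c.support.erase p, p.1 < q.1 ∨ p.2 < q.2 := by
    intro q hq
    rw [Finset.mem_erase] at hq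
    by_contra! hle
    have hlt : q.1 + q.2 < p.1 + p.2 := by
      by_contra! hge
      exact hq.1 (Prod.ext (by omega) (by omega))
    obtain ⟨g, hg, hgq⟩ := ih _ hlt q hq.2 rfl
    exact hcon g hg (hgq.trans ⟨hle.1, hle.2⟩)
  have hsum := hc.2
  rw [Finsupp.sum, ← Finset.add_sum_erase _ _ hp] at hsum
  have hmem : c p * (x ^ p.1 * y ^ p.2) ∈ Ideal.span {x ^ (p.1 + 1), y ^ (p.2 + 1)} := by
    rw [← sub_eq_iff_eq_add] at hsum
    rw [← hsum]
    refine sub_mem (monomialIdeal_le_span ?_ hf) (Ideal.sum_mem _ fun q hqs =>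
      Ideal.mul_mem_left _ _ (monomialIdeal_le_span (G := c.support.erase p) ?_
        (monomial_mem (i := q.1) (j := q.2) hqs)))
    · intro i j hij
      by_contra! hle
      exact hcon _ hij ⟨hle.1, hle.2⟩
    · exact fun i j hij => hq (i, j) hij
  exact (mem_maximalIdeal _).1 (h.coeff_mem hmem) (hc.1 p hp)

end MonomialIdeal

/-! ### Weight filtrations and comparison of two systems of parameters. -/

section WeightFiltration

variable {R : Type u} [CommRing R]

/-- The ideal generated by the monomials `x ^ i * y ^ j` with `d * i + j ≥ s`. -/
def weightGe (x y : R) (d s : ℝ) : Ideal R :=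
  monomialIdeal x y {p | s ≤ d * p.1 + p.2}

/-- The ideal generated by the monomials `x ^ i * y ^ j` with `d * i + j > s`. -/
def weightGt (x y : R) (d s : ℝ) : Ideal R :=
  monomialIdeal x y {p | s < d * p.1 + p.2}

theorem weightGe_le_weightGt {x y : R} {d s t : ℝ} (h : s < t) :
    weightGe x y d t ≤ weightGt x y d s :=
  monomialIdeal_mono fun _ hp => h.trans_le hp

theorem weightGe_anti {x y : R} {d s t : ℝ} (h : s ≤ t) :
    weightGe x y d t ≤ weightGe x y d s :=
  monomialIdeal_mono fun _ hp => h.trans hp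

theorem weightGe_mul_le (x y : R) (d s t : ℝ) :
    weightGe x y d s * weightGe x y d t ≤ weightGe x y d (s + t) := by
  rw [weightGe, weightGe, monomialIdeal, monomialIdeal, Ideal.span_mul_span', Ideal.span_le]
  rintro _ ⟨_, ⟨⟨i, j⟩, hij, rfl⟩, _, ⟨⟨k, l⟩, hkl, rfl⟩, rfl⟩
  have : x ^ (i + k) * y ^ (j + l) ∈ weightGe x y d (s + t) := by
    refine monomial_mem ?_
    simp only [Set.mem_ofPred_eq] at hij hkl ⊢
    push_cast
    linarith
  have heq : x ^ i * y ^ j * (x ^ k * y ^ l) = x ^ (i + k) * y ^ (j + l) := by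
    simp only [pow_add]
    ring
  rw [← heq] at this
  exact this

theorem mul_mem_weightGe {x y a b : R} {d s t : ℝ} (ha : a ∈ weightGe x y d s)
    (hb : b ∈ weightGe x y d t) : a * b ∈ weightGe x y d (s + t) :=
  weightGe_mul_le x y d s t (Ideal.mul_mem_mul ha hb)

theorem weightGe_zero (x y : R) (d : ℝ) : weightGe x y d 0 = ⊤ := by
  rw [Ideal.eq_top_iff_one]
  have : x ^ 0 * y ^ 0 ∈ weightGe x y d 0 := monomial_mem (by simp)
  simpa using this

theorem pow_mem_weightGe {x y a : R} {d s : ℝ} (ha : a ∈ weightGe x y d s) (n : ℕ) :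
    a ^ n ∈ weightGe x y d (n * s) := by
  induction n with
  | zero => simp [weightGe_zero]
  | succ n ih =>
    rw [pow_succ]
    convert mul_mem_weightGe ih ha using 2
    push_cast
    ring

theorem left_mem_weightGe (x y : R) (d : ℝ) : x ∈ weightGe x y d d := by
  have : x ^ 1 * y ^ 0 ∈ weightGe x y d d := monomial_mem (by simp)
  simpa using this

theorem right_pow_mem_weightGe (x y : R) {d s : ℝ} {n : ℕ} (h : s ≤ n) :
    y ^ n ∈ weightGe x y d s := by
  have : x ^ 0 * y ^ n ∈ weightGe x y d s := monomial_mem (by simpa)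
  simpa using this

theorem monomial_mem_weightGe {x₁ x₂ y₁ y₂ : R} {d : ℝ} (h₁ : y₁ ∈ weightGe x₁ x₂ d d)
    (h₂ : y₂ ∈ weightGe x₁ x₂ d 1) (i j : ℕ) :
    y₁ ^ i * y₂ ^ j ∈ weightGe x₁ x₂ d (d * i + j) := by
  convert mul_mem_weightGe (pow_mem_weightGe h₁ i) (pow_mem_weightGe h₂ j) using 2
  ring

theorem weightGe_le_of_mem {x₁ x₂ y₁ y₂ : R} {d : ℝ} (h₁ : y₁ ∈ weightGe x₁ x₂ d d)
    (h₂ : y₂ ∈ weightGe x₁ x₂ d 1) (s : ℝ) : weightGe y₁ y₂ d s ≤ weightGe x₁ x₂ d s :=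
  monomialIdeal_le.2 fun i j hij => weightGe_anti hij (monomial_mem_weightGe h₁ h₂ i j)

theorem weightGt_le_of_mem {x₁ x₂ y₁ y₂ : R} {d : ℝ} (h₁ : y₁ ∈ weightGe x₁ x₂ d d)
    (h₂ : y₂ ∈ weightGe x₁ x₂ d 1) (s : ℝ) : weightGt y₁ y₂ d s ≤ weightGt x₁ x₂ d s :=
  monomialIdeal_le.2 fun i j hij => weightGe_le_weightGt hij (monomial_mem_weightGe h₁ h₂ i j)

theorem span_pair_pow_le_weightGe (x y : R) {d : ℝ} {n : ℕ} (h : d ≤ n) :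
    Ideal.span {x, y ^ n} ≤ weightGe x y d d := by
  rw [Ideal.span_le]
  rintro _ (rfl | rfl)
  exacts [left_mem_weightGe _ _ _, right_pow_mem_weightGe _ _ h]

/-- The ideal generated by `x ^ n` and the monomials of weight greater than `d * n`, where
`x` has weight `d` and `y` has weight `1`. -/
def initialIdeal (x y : R) (d : ℝ) (n : ℕ) : Ideal R :=
  monomialIdeal x y {p | p = (n, 0) ∨ d * n < d * p.1 + p.2}

theorem initialIdeal_eq (x y : R) (d : ℝ) (n : ℕ) :
    initialIdeal x y d n = Ideal.span {x ^ n} ⊔ weightGt x y d (d * n) := by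
  have : {p : ℕ × ℕ | p = (n, 0) ∨ d * n < d * p.1 + p.2} =
    {(n, 0)} ∪ {p : ℕ × ℕ | d * n < d * p.1 + p.2} := rfl
  rw [initialIdeal, this, monomialIdeal, Set.image_union, Ideal.span_union, Set.image_singleton,
    weightGt, monomialIdeal]
  simp

theorem initialIdeal_le_weightGe (x y : R) (d : ℝ) (n : ℕ) :
    initialIdeal x y d n ≤ weightGe x y d (d * n) := by
  refine monomialIdeal_mono ?_
  rintro p (rfl | hp)
  · simp
  · exact le_of_lt hp

variable [IsLocalRing R]

theorem IsParameters.maximalIdeal_le_weightGe {x y : R} (h : IsParameters x y) {d : ℝ}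
    (hd : 1 ≤ d) : maximalIdeal R ≤ weightGe x y d 1 := by
  rw [← h.span_eq, Ideal.span_le]
  rintro _ (rfl | rfl)
  · exact weightGe_anti hd (left_mem_weightGe _ _ _)
  · simpa using right_pow_mem_weightGe x _ (d := d) (s := 1) (n := 1) (by simp)

theorem IsParameters.pow_le_weightGe {x y : R} (h : IsParameters x y) {d : ℝ} (hd : 1 ≤ d)
    (n : ℕ) : maximalIdeal R ^ n ≤ weightGe x y d n := by
  induction n with
  | zero => simp [weightGe_zero]
  | succ n ih =>
    rw [pow_succ]
    push_cast
    exact (Ideal.mul_mono ih (h.maximalIdeal_le_weightGe hd)).trans (weightGe_mul_le x y d n 1)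

theorem IsParameters.monomialIdeal_le_pow {x y : R} (h : IsParameters x y)
    {G : Set (ℕ × ℕ)} {n : ℕ} (hG : ∀ i j, (i, j) ∈ G → n ≤ i + j) :
    monomialIdeal x y G ≤ maximalIdeal R ^ n := by
  rw [monomialIdeal_le]
  intro i j hij
  refine Ideal.pow_le_pow_right (hG i j hij) ?_
  rw [pow_add]
  exact Ideal.mul_mem_mul (Ideal.pow_mem_pow h.mem_left i) (Ideal.pow_mem_pow h.mem_right j)

/-- If `f` has weight at least `d * n` for two weight filtrations, and order `n`, then the two
parameters of weight `d` are congruent up to a unit modulo elements of weight `d`. -/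
theorem IsParameters.mem_span_of_mem_weightGe {x₁ x₂ y₁ y₂ f : R} (hx : IsParameters x₁ x₂)
    (hy : IsParameters y₁ y₂) {d : ℝ} {n : ℕ} (hn : 0 < n)
    (hfx : f ∈ weightGe x₁ x₂ d (d * n)) (hfy : f ∈ weightGe y₁ y₂ d (d * n))
    (hf : f ∉ maximalIdeal R ^ (n + 1)) : y₁ ∈ Ideal.span {x₁, x₂ ^ ⌈d⌉₊} := by
  by_cases hmem : y₁ ∈ Ideal.span {x₁}
  · exact Ideal.span_mono (by simp) hmem
  obtain ⟨a, β, j, hβ, hy₁⟩ := hx.exists_isUnit hmem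
  by_cases hj : ⌈d⌉₊ ≤ j
  · rw [hy₁]
    exact add_mem (Ideal.mul_mem_left _ _ (Ideal.subset_span (by simp))) (Ideal.mul_mem_left _ _
      (Ideal.mem_of_dvd _ (pow_dvd_pow _ hj) (Ideal.subset_span (by simp))))
  exfalso
  rw [not_le, Nat.lt_ceil] at hj
  have hj0 : 1 ≤ j := by
    by_contra! h0
    obtain rfl : j = 0 := by omega
    have : β = y₁ - a * x₁ := by rw [hy₁]; ring
    exact (mem_maximalIdeal _).1
      (this ▸ sub_mem hy.mem_left (Ideal.mul_mem_left _ _ hx.mem_left)) hβ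
  have hd1 : 1 < d := lt_of_le_of_lt (by exact_mod_cast hj0) hj
  -- Here `y₁ = a * x₁ + β * x₂ ^ j` with `β` a unit and `1 ≤ j < d`. Write `f = u * y₁ ^ n + s`; as
  -- `d > 1`, the monomials of `s` have degree above `n`, so `u` is a unit.
  have hsup : weightGe y₁ y₂ d (d * n) ≤ Ideal.span {y₁ ^ n} ⊔
      monomialIdeal y₁ y₂ {p | p.1 < n ∧ d * n ≤ d * p.1 + p.2} := by
    refine monomialIdeal_le.2 fun i k hik => ?_
    rcases lt_or_ge i n with hi | hi
    · exact Ideal.mem_sup_right (monomial_mem ⟨hi, hik⟩)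
    · exact Ideal.mem_sup_left (Ideal.mul_mem_right _ _
        (Ideal.mem_of_dvd _ (pow_dvd_pow _ hi) (Ideal.subset_span rfl)))
  obtain ⟨_, hu, s, hs, hus⟩ := Submodule.mem_sup.1 (hsup hfy)
  obtain ⟨u, rfl⟩ := Ideal.mem_span_singleton'.1 hu
  have hsm : s ∈ maximalIdeal R ^ (n + 1) := by
    refine hy.monomialIdeal_le_pow ?_ hs
    rintro i k ⟨hi, hik⟩
    have hi' : (i : ℝ) + 1 ≤ n := by exact_mod_cast hi
    have : (n : ℝ) < i + k := by nlinarith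
    have : n < i + k := by exact_mod_cast this
    exact this
  have hunit : IsUnit u := by
    by_contra hu'
    refine hf (hus ▸ add_mem ?_ hsm)
    rw [pow_succ']
    exact Ideal.mul_mem_mul ((mem_maximalIdeal _).2 hu') (Ideal.pow_mem_pow hy.mem_left n)
  -- Modulo `I`, `y₁` is `β * x₂ ^ j` and `y₂` a multiple of `x₂`. Both `f` and `s` vanish because
  -- `j < d`, but `u * y₁ ^ n` becomes a unit times `x₂ ^ (j * n)`, which does not.
  set I : Ideal R := Ideal.span {x₁ ^ (0 + 1), x₂ ^ (j * n + 1)} with hI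
  have hx₁I : Ideal.Quotient.mk I x₁ = 0 :=
    Ideal.Quotient.eq_zero_iff_mem.2 (Ideal.subset_span (by simp))
  have hx₂I : ∀ k, j * n < k → Ideal.Quotient.mk I x₂ ^ k = 0 := by
    intro k hk
    rw [← map_pow]
    exact Ideal.Quotient.eq_zero_iff_mem.2
      (Ideal.mem_of_dvd _ (pow_dvd_pow _ hk) (Ideal.subset_span (by simp)))
  have hjn : (j : ℝ) * n < d * n := by
    have : (0 : ℝ) < n := by exact_mod_cast hn
    exact mul_lt_mul_of_pos_right hj this
  have hy₁I : Ideal.Quotient.mk I y₁ = Ideal.Quotient.mk I β * Ideal.Quotient.mk I x₂ ^ j := by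
    rw [hy₁, map_add, map_mul, hx₁I, mul_zero, zero_add, map_mul, map_pow]
  obtain ⟨γ, ε, hy₂⟩ := hx.exists_eq_add hy.mem_right
  have hy₂I : Ideal.Quotient.mk I y₂ = Ideal.Quotient.mk I ε * Ideal.Quotient.mk I x₂ := by
    rw [hy₂, map_add, map_mul, hx₁I, mul_zero, zero_add, map_mul]
  have hfI : f ∈ I := by
    refine monomialIdeal_le_span ?_ hfx
    intro i k hik
    have hik : d * n ≤ d * i + k := hik
    rcases Nat.eq_zero_or_pos i with rfl | hi
    · right
      have : (j : ℝ) * n < k := by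
        simp only [Nat.cast_zero, mul_zero, zero_add] at hik
        linarith
      exact_mod_cast this
    · exact Or.inl hi
  have hsI : s ∈ I := by
    refine monomialIdeal_le.2 ?_ hs
    rintro i k ⟨hi, hik⟩
    have hik : d * n ≤ d * i + k := hik
    rw [← Ideal.Quotient.eq_zero_iff_mem, map_mul, map_pow, map_pow, hy₁I, hy₂I]
    have hlt : j * n < j * i + k := by
      have hi' : (i : ℝ) + 1 ≤ n := by exact_mod_cast hi
      have : (j : ℝ) * n < j * i + k := by nlinarith
      exact_mod_cast this
    have := hx₂I _ hlt
    rw [pow_add, pow_mul] at this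
    linear_combination (Ideal.Quotient.mk I β ^ i * Ideal.Quotient.mk I ε ^ k) * this
  have hmain : u * β ^ n * (x₁ ^ 0 * x₂ ^ (j * n)) ∈ I := by
    have h0 := sub_mem hfI hsI
    rw [← hus, add_sub_cancel_right] at h0
    rw [← Ideal.Quotient.eq_zero_iff_mem] at h0 ⊢
    rw [map_mul, map_pow, hy₁I] at h0
    simp only [map_mul, map_pow, pow_zero, one_mul]
    rw [← h0, pow_mul]
    ring
  exact (mem_maximalIdeal _).1 (hx.coeff_mem hmain) (hunit.mul (hβ.pow n))

theorem IsParameters.mem_weightGe_of_mem {x₁ x₂ y₁ y₂ f : R} (hx : IsParameters x₁ x₂)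
    (hy : IsParameters y₁ y₂) {d : ℝ} {n : ℕ} (hn : 0 < n)
    (hfx : f ∈ weightGe x₁ x₂ d (d * n)) (hfy : f ∈ weightGe y₁ y₂ d (d * n))
    (hf : f ∉ maximalIdeal R ^ (n + 1)) : y₁ ∈ weightGe x₁ x₂ d d :=
  span_pair_pow_le_weightGe _ _ (Nat.le_ceil d) (hx.mem_span_of_mem_weightGe hy hn hfx hfy hf)

/-- `(x₁ ^ n, x₂ ^ (n * d))` is the candidate for the maximal center of an element `f` of order
`n`: the weight of `f` is at least that of `x₁ ^ n`, and no parameters `(y, z)` are such that the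
initial form of `f` for the weights `(d, 1)` is a constant times `y ^ n`. -/
structure IsMaximalWeight (f x₁ x₂ : R) (d : ℝ) (n : ℕ) : Prop where
  isParameters : IsParameters x₁ x₂
  pos : 0 < n
  one_le : 1 ≤ d
  mem : f ∈ weightGe x₁ x₂ d (d * n)
  not_mem_pow : f ∉ maximalIdeal R ^ (n + 1)
  not_mem_initialIdeal : ∀ y z : R, IsParameters y z → f ∉ initialIdeal y z d n

end WeightFiltration

/-! ### Maximality and uniqueness of the center. -/

section Center

variable {R : Type u} [CommRing R] [IsLocalRing R]

namespace Center

theorem weightIdeal_eq (J : Center R) (t : ℝ) :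
    J.weightIdeal t = weightGe J.x₁ J.x₂ ((J.a₂ : ℝ) / J.a₁) (t * J.a₂) := by
  have h1 : (0 : ℝ) < J.a₁ := by exact_mod_cast J.a₁_pos
  have h2 : (0 : ℝ) < J.a₂ := by exact_mod_cast J.a₂_pos
  rw [weightIdeal, weightGe, monomialIdeal]
  congr 1
  ext m
  have key : ∀ i j : ℕ, t ≤ (i : ℝ) / J.a₁ + (j : ℝ) / J.a₂ ↔
      t * J.a₂ ≤ (J.a₂ : ℝ) / J.a₁ * i + j := by
    intro i j
    rw [← mul_le_mul_iff_left₀ h2]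
    have : ((i : ℝ) / J.a₁ + (j : ℝ) / J.a₂) * J.a₂ = (J.a₂ : ℝ) / J.a₁ * i + j := by
      field_simp
    rw [this]
  constructor
  · rintro ⟨i, j, hij, rfl⟩
    exact ⟨(i, j), (key i j).1 hij, rfl⟩
  · rintro ⟨⟨i, j⟩, hij, rfl⟩
    exact ⟨i, j, (key i j).2 hij, rfl⟩

theorem isAdmissible_of_mem {J : Center R} {f : R} (h : f ∈ J.weightIdeal 1) :
    J.IsAdmissible f :=
  le_sSup ⟨1, h, rfl⟩

/-- The weights of monomials are discrete, so that the supremum in the valuation is attained. -/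
theorem IsAdmissible.mem {J : Center R} {f : R} (h : J.IsAdmissible f) :
    f ∈ J.weightIdeal 1 := by
  have hp₁ : 0 < J.a₁.num := Rat.num_pos.2 J.a₁_pos
  have hp₂ : 0 < J.a₂.num := Rat.num_pos.2 J.a₂_pos
  -- `N` is a common denominator of all weights `i / a₁ + j / a₂`, so a weight exceeding `1 - 1 / N`
  -- is at least `1`.
  set N : ℤ := J.a₁.num * J.a₂.num with hN
  have hN0 : 0 < N := mul_pos hp₁ hp₂
  have hN0' : (0 : ℝ) < N := by exact_mod_cast hN0
  have hlt : ((1 - 1 / (N : ℝ) : ℝ) : EReal) < J.val f := by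
    refine lt_of_lt_of_le ?_ h
    have : 1 - 1 / (N : ℝ) < 1 := by
      have := one_div_pos.2 hN0'
      linarith
    exact_mod_cast this
  obtain ⟨_, ⟨t, ht, rfl⟩, hlt⟩ := lt_sSup_iff.1 hlt
  rw [EReal.coe_lt_coe_iff] at hlt
  refine Ideal.span_mono ?_ ht
  rintro _ ⟨i, j, hij, rfl⟩
  refine ⟨i, j, ?_, rfl⟩
  have h1 : (J.a₁ : ℝ) = (J.a₁.num : ℝ) / J.a₁.den := by exact_mod_cast (Rat.num_div_den J.a₁).symm
  have h2 : (J.a₂ : ℝ) = (J.a₂.num : ℝ) / J.a₂.den := by exact_mod_cast (Rat.num_div_den J.a₂).symm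
  have hp₁' : (0 : ℝ) < J.a₁.num := by exact_mod_cast hp₁
  have hp₂' : (0 : ℝ) < J.a₂.num := by exact_mod_cast hp₂
  have hw : (i : ℝ) / J.a₁ + (j : ℝ) / J.a₂ =
      ((i * J.a₁.den * J.a₂.num + j * J.a₂.den * J.a₁.num : ℤ) : ℝ) / N := by
    rw [h1, h2, hN]
    push_cast
    field_simp
  rw [hw] at hij ⊢
  rw [le_div_iff₀ hN0', one_mul]
  have h3 := hlt.trans_le hij
  rw [lt_div_iff₀ hN0', sub_mul, one_div, inv_mul_cancel₀ hN0'.ne', one_mul] at h3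
  have h4 : N - 1 < i * J.a₁.den * J.a₂.num + j * J.a₂.den * J.a₁.num := by exact_mod_cast h3
  have h5 : N ≤ i * J.a₁.den * J.a₂.num + j * J.a₂.den * J.a₁.num := by omega
  exact_mod_cast h5

end Center

theorem IsMaximalWeight.isUniqueMaximalAdmissible {f x₁ x₂ : R} {δ : ℚ} {n : ℕ}
    (h : IsMaximalWeight f x₁ x₂ δ n) (J : Center R) (h₁ : J.x₁ = x₁) (h₂ : J.x₂ = x₂)
    (ha₁ : J.a₁ = n) (ha₂ : J.a₂ = n * δ) : J.IsUniqueMaximalAdmissible f := by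
  have hn : (0 : ℚ) < n := by exact_mod_cast h.pos
  have hn' : (0 : ℝ) < n := by exact_mod_cast h.pos
  have hδ : (1 : ℚ) ≤ δ := by exact_mod_cast h.one_le
  have hdiv : ((J.a₂ : ℝ) / J.a₁) = δ := by
    rw [ha₁, ha₂]
    push_cast
    field_simp
  have hle : J.a₁ ≤ J.a₂ := by
    rw [ha₁, ha₂]
    exact le_mul_of_one_le_right hn.le hδ
  refine ⟨hle, Center.isAdmissible_of_mem ?_, ?_⟩
  · rw [Center.weightIdeal_eq, hdiv, h₁, h₂, ha₂, one_mul]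
    convert h.mem using 2
    push_cast
    ring
  intro J' hle' hadm
  have hmem := hadm.mem
  have hb₁ : (0 : ℝ) < J'.a₁ := by exact_mod_cast J'.a₁_pos
  have hb₂ : (0 : ℝ) < J'.a₂ := by exact_mod_cast J'.a₂_pos
  have hle'' : (J'.a₁ : ℝ) ≤ J'.a₂ := by exact_mod_cast hle'
  rw [Center.weightIdeal_eq, one_mul] at hmem
  have hle₁ : J'.a₁ ≤ J.a₁ := by
    by_contra! hcon
    rw [ha₁] at hcon
    have hcon' : (n : ℝ) < J'.a₁ := by exact_mod_cast hcon
    refine h.not_mem_pow (J'.isParameters.monomialIdeal_le_pow ?_ hmem)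
    intro i j hij
    have hij : (J'.a₂ : ℝ) ≤ J'.a₂ / J'.a₁ * i + j := hij
    have hr : 1 ≤ (J'.a₂ : ℝ) / J'.a₁ := (one_le_div hb₁).2 hle''
    have hj : (j : ℝ) ≤ (J'.a₂ : ℝ) / J'.a₁ * j := le_mul_of_one_le_left (Nat.cast_nonneg j) hr
    have h3 : (J'.a₂ : ℝ) = J'.a₂ / J'.a₁ * J'.a₁ := by field_simp
    have h4 : (J'.a₁ : ℝ) ≤ i + j := by
      refine le_of_mul_le_mul_left (a := (J'.a₂ : ℝ) / J'.a₁) ?_ (by linarith)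
      linarith
    have h5 : (n : ℝ) < i + j := by linarith
    exact_mod_cast h5
  have hle₂ : J'.a₁ = J.a₁ → J'.a₂ ≤ J.a₂ := by
    intro heq
    by_contra! hcon
    rw [ha₁] at heq
    rw [ha₂] at hcon
    have hcon' : (n : ℝ) * δ < J'.a₂ := by exact_mod_cast hcon
    -- With `b₁ = n` and `b₂ / n > δ`, every monomial admissible for `J'` other than `y₁ ^ n` itself
    -- has `(δ, 1)`-weight above `δ * n`.
    refine h.not_mem_initialIdeal _ _ J'.isParameters (monomialIdeal_mono ?_ hmem)
    rintro ⟨i, j⟩ hij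
    have hij : (J'.a₂ : ℝ) ≤ J'.a₂ / J'.a₁ * i + j := hij
    rw [heq] at hij
    push_cast at hij
    simp only [Set.mem_ofPred_eq, Prod.mk.injEq]
    have hd : (0 : ℝ) < δ := lt_of_lt_of_le one_pos h.one_le
    have hi0 : (0 : ℝ) ≤ i := Nat.cast_nonneg i
    have hj0 : (0 : ℝ) ≤ j := Nat.cast_nonneg j
    rcases lt_trichotomy i n with hi | rfl | hi
    · right
      have hi' : (i : ℝ) < n := by exact_mod_cast hi
      have h6 : (J'.a₂ : ℝ) / n * n = J'.a₂ := by field_simp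
      have h7 : (δ : ℝ) < J'.a₂ / n := by
        rw [lt_div_iff₀ hn']
        linarith
      nlinarith
    · rcases Nat.eq_zero_or_pos j with rfl | hj
      · exact Or.inl ⟨rfl, rfl⟩
      · right
        have : (0 : ℝ) < j := by exact_mod_cast hj
        linarith
    · right
      have hi' : (n : ℝ) < i := by exact_mod_cast hi
      nlinarith
  refine ⟨?_, fun heq => ?_⟩
  · rw [Center.inv, Center.inv, Prod.Lex.toLex_le_toLex]
    rcases hle₁.lt_or_eq with hlt | heq
    · exact Or.inl hlt
    · exact Or.inr ⟨heq, hle₂ heq⟩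
  · have heq' := toLex.injective heq
    rw [Prod.mk.injEq] at heq'
    have hdiv' : ((J'.a₂ : ℝ) / J'.a₁) = δ := by rw [heq'.1, heq'.2, hdiv]
    have hfy : f ∈ weightGe J'.x₁ J'.x₂ δ (δ * n) := by
      rw [hdiv', heq'.2, ha₂] at hmem
      convert hmem using 2
      push_cast
      ring
    have hx := h.isParameters
    have hy := J'.isParameters
    have hxy := hx.mem_weightGe_of_mem hy h.pos h.mem hfy h.not_mem_pow
    have hyx := hy.mem_weightGe_of_mem hx h.pos hfy h.mem h.not_mem_pow
    have hI : J'.weightIdeal = J.weightIdeal := by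
      funext t
      rw [Center.weightIdeal_eq, Center.weightIdeal_eq, hdiv', hdiv, h₁, h₂, heq'.2]
      exact le_antisymm
        (weightGe_le_of_mem hxy (hx.maximalIdeal_le_weightGe h.one_le hy.mem_right) _)
        (weightGe_le_of_mem hyx (hy.maximalIdeal_le_weightGe h.one_le hx.mem_right) _)
    funext g
    rw [Center.val, Center.val, hI]

end Center

/-! ### From the characteristic polyhedron to the maximal weight. -/

section CharacteristicPolyhedron

variable {R : Type u} [CommRing R]

theorem initialIdeal_le_of_mem {x y z : R} {d : ℝ} (h : z ∈ weightGe x y d 1) (n : ℕ) :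
    initialIdeal x z d n ≤ initialIdeal x y d n := by
  rw [initialIdeal_eq, initialIdeal_eq]
  exact sup_le_sup_left (weightGt_le_of_mem (left_mem_weightGe _ _ _) h _) _

variable [IsLocalRing R]

theorem order_spec [IsNoetherianRing R] {f : R} (hf : f ≠ 0) :
    f ∈ maximalIdeal R ^ order f ∧ f ∉ maximalIdeal R ^ (order f + 1) := by
  have hbot := Ideal.iInf_pow_eq_bot_of_isLocalRing (maximalIdeal R) Ideal.IsPrime.ne_top'
  obtain ⟨N, hN⟩ : ∃ N, f ∉ maximalIdeal R ^ N := by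
    by_contra! hcon
    exact hf (by simpa [hbot] using Ideal.mem_iInf.2 hcon)
  have hbdd : BddAbove {n : ℕ | f ∈ maximalIdeal R ^ n} := by
    refine ⟨N, fun n hn => ?_⟩
    by_contra! hlt
    exact hN (Ideal.pow_le_pow_right hlt.le hn)
  refine ⟨Nat.sSup_mem (s := {n : ℕ | f ∈ maximalIdeal R ^ n}) ⟨0, by simp⟩ hbdd, fun hmem => ?_⟩
  have hle : order f + 1 ≤ order f := le_csSup hbdd hmem
  omega

theorem IsParameters.not_mem_sq {x y : R} (h : IsParameters x y) : x ∉ maximalIdeal R ^ 2 := by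
  intro hx
  have h1 : (1 : R) * (x ^ 1 * y ^ 0) ∈ weightGe x y 1 (2 : ℕ) := by
    simpa using h.pow_le_weightGe le_rfl 2 hx
  refine (Ideal.ne_top_iff_one _).1 (Ideal.IsPrime.ne_top' (I := maximalIdeal R))
    (h.coeff_mem_of_mem_monomialIdeal (fun i j hij => ?_) h1)
  have hij : ((2 : ℕ) : ℝ) ≤ 1 * i + j := hij
  rw [one_mul] at hij
  have : 2 ≤ i + j := by exact_mod_cast hij
  omega

theorem IsParameters.weightGt_le_pow {x y : R} (h : IsParameters x y) {d : ℝ} (hd : 1 ≤ d)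
    (n : ℕ) : weightGt x y d (d * n) ≤ maximalIdeal R ^ (n + 1) := by
  refine h.monomialIdeal_le_pow fun i j hij => ?_
  have hij : d * n < d * i + j := hij
  have hj : (j : ℝ) ≤ d * j := le_mul_of_one_le_left (Nat.cast_nonneg j) hd
  have : (n : ℝ) < i + j := lt_of_mul_lt_mul_left (by linarith) (by linarith : 0 ≤ d)
  have : n < i + j := by exact_mod_cast this
  exact this

theorem IsParameters.exists_isUnit_of_mem_initialIdeal {x y f : R} (h : IsParameters x y) {d : ℝ}
    (hd : 1 ≤ d) {n : ℕ} (hf : f ∈ initialIdeal x y d n) (hfn : f ∉ maximalIdeal R ^ (n + 1)) :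
    ∃ u, IsUnit u ∧ f - u * x ^ n ∈ maximalIdeal R ^ (n + 1) := by
  rw [initialIdeal_eq] at hf
  obtain ⟨_, hu, s, hs, rfl⟩ := Submodule.mem_sup.1 hf
  obtain ⟨u, rfl⟩ := Ideal.mem_span_singleton'.1 hu
  have hs' := h.weightGt_le_pow hd n hs
  refine ⟨u, ?_, by simpa using hs'⟩
  by_contra hu'
  refine hfn (add_mem ?_ hs')
  rw [pow_succ']
  exact Ideal.mul_mem_mul ((mem_maximalIdeal _).2 hu') (Ideal.pow_mem_pow h.mem_left n)

theorem IsParameters.mem_initialIdeal_one {x y f u : R} (h : IsParameters x y) {n : ℕ}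
    (hf : f - u * x ^ n ∈ maximalIdeal R ^ (n + 1)) : f ∈ initialIdeal x y 1 n := by
  rw [initialIdeal_eq, ← sub_add_cancel f (u * x ^ n)]
  refine add_mem (Ideal.mem_sup_right ?_)
    (Ideal.mem_sup_left (Ideal.mul_mem_left _ _ (Ideal.subset_span rfl)))
  exact weightGe_le_weightGt (by simp) (h.pow_le_weightGe le_rfl (n + 1) hf)

/-- Each exponent of an expansion dominates that of a generator of the initial ideal. When `b` is
below the order, this generator is not the pure power of `y`, so it has weight strictly above `d *
order f`. -/
theorem IsParameters.projectedPolyhedron_subset {x y f : R} (h : IsParameters y x) {d : ℝ}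
    (hf : f ∈ initialIdeal y x d (order f)) : projectedPolyhedron f x y ⊆ Set.Ioi d := by
  refine convexHull_min ?_ (convex_Ioi d)
  rintro _ ⟨c, hc, p, hp, hlt, s, hs, rfl⟩
  have hf' : f ∈ monomialIdeal x y
      {p | p = (0, order f) ∨ d * order f < d * p.2 + p.1} := by
    refine monomialIdeal_le.2 ?_ hf
    intro i j hij
    rw [mul_comm (y ^ i)]
    refine monomial_mem ?_
    rcases hij with hij | hij
    · rw [Prod.mk.injEq] at hij
      exact Or.inl (by rw [hij.1, hij.2])
    · exact Or.inr hij
  obtain ⟨g, hg, hgp⟩ := hc.exists_le h.symm hf' p hp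
  have hlt' : (0 : ℝ) < order f - p.2 := sub_pos.2 (by exact_mod_cast hlt)
  have h1 : (g.1 : ℝ) ≤ p.1 := by exact_mod_cast hgp.1
  have hg2 : g.2 < order f := lt_of_le_of_lt hgp.2 hlt
  have h2 : (g.2 : ℝ) ≤ p.2 := by exact_mod_cast hgp.2
  have h3 : d < (p.1 : ℝ) / (order f - p.2) := by
    rcases hg with rfl | hg
    · exact absurd hg2 (lt_irrefl _)
    have hg : d * order f < d * g.2 + g.1 := hg
    rw [lt_div_iff₀ hlt']
    rcases lt_or_ge d 0 with hd | hd
    · have : d * ((order f : ℝ) - p.2) < 0 := mul_neg_of_neg_of_pos hd hlt'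
      exact this.trans_le (Nat.cast_nonneg _)
    · have := mul_le_mul_of_nonneg_left h2 hd
      linarith
  simp only [Set.mem_Ioi]
  linarith

theorem mem_weightGe_of_projectedPolyhedron_eq {x y f : R} {d : ℝ} (hd : 0 ≤ d)
    (h : projectedPolyhedron f x y = Set.Ici d) : f ∈ weightGe y x d (d * order f) := by
  have hmem : d ∈ projectedPolyhedron f x y := h ▸ Set.self_mem_Ici
  -- Nonemptiness of the polyhedron supplies an expansion; its existence need not be proved
  -- separately.
  obtain ⟨_, c, hc, -⟩ := convexHull_nonempty_iff.1 ⟨d, hmem⟩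
  suffices hsum : (c.sum fun p a => a * (x ^ p.1 * y ^ p.2)) ∈
      weightGe y x d (d * order f) by rwa [← hc.2] at hsum
  refine Ideal.sum_mem _ fun p hp => Ideal.mul_mem_left _ _ ?_
  rw [mul_comm (x ^ p.1)]
  refine monomial_mem ?_
  simp only [Set.mem_ofPred_eq]
  have hp1 : (0 : ℝ) ≤ p.1 := Nat.cast_nonneg _
  rcases lt_or_ge p.2 (order f) with hlt | hge
  · have h1 : (p.1 : ℝ) / ((order f : ℝ) - p.2) ∈ projectedPolyhedron f x y :=
      subset_convexHull ℝ _ ⟨c, hc, p, hp, hlt, 0, le_rfl, by simp⟩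
    rw [h, Set.mem_Ici, le_div_iff₀ (sub_pos.2 (by exact_mod_cast hlt))] at h1
    linarith
  · have hge' : (order f : ℝ) ≤ p.2 := by exact_mod_cast hge
    have := mul_le_mul_of_nonneg_left hge' hd
    linarith

/-- The two linear forms must be proportional: for `z = a * y + b * x`, reduction modulo `(y, x ^ (n
+ 1))` leaves `v * b ^ n * x ^ n = 0`, so `b` is not a unit and `a` is. -/
theorem IsParameters.of_hasInitialPower {x y z w f u v : R} (h : IsParameters y x)
    (h' : IsParameters z w) {n : ℕ} (hn : n ≠ 0) (hv : IsUnit v)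
    (hy : f - u * y ^ n ∈ maximalIdeal R ^ (n + 1))
    (hz : f - v * z ^ n ∈ maximalIdeal R ^ (n + 1)) : IsParameters z x := by
  obtain ⟨a, b, rfl⟩ := h.exists_eq_add h'.mem_left
  have hb : b ∈ maximalIdeal R := by
    set I : Ideal R := Ideal.span {y ^ (0 + 1), x ^ (n + 1)} with hI
    have hle : maximalIdeal R ^ (n + 1) ≤ I := by
      refine (h.pow_le_weightGe le_rfl (n + 1)).trans (monomialIdeal_le_span fun i j hij => ?_)
      have hij : ((n + 1 : ℕ) : ℝ) ≤ 1 * i + j := hij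
      rw [one_mul] at hij
      have : n + 1 ≤ i + j := by exact_mod_cast hij
      omega
    have hyI : Ideal.Quotient.mk I y = 0 :=
      Ideal.Quotient.eq_zero_iff_mem.2 (Ideal.subset_span (by simp))
    have hdiff := sub_mem (hle hy) (hle hz)
    rw [← Ideal.Quotient.eq_zero_iff_mem] at hdiff
    have hmem : v * b ^ n * (y ^ 0 * x ^ n) ∈ I := by
      rw [← Ideal.Quotient.eq_zero_iff_mem, ← hdiff]
      simp only [map_mul, map_pow, map_sub, map_add, hyI, pow_zero, map_one, mul_zero, zero_add,
        zero_pow hn]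
      ring
    have := h.coeff_mem hmem
    by_contra hb
    exact (mem_maximalIdeal _).1 this
      (hv.mul ((of_not_not fun hb' => hb ((mem_maximalIdeal _).2 hb') : IsUnit b).pow n))
  have ha : IsUnit a := by
    by_contra ha
    refine h'.not_mem_sq ?_
    rw [pow_two]
    exact add_mem (Ideal.mul_mem_mul ((mem_maximalIdeal _).2 ha) h.mem_left)
      (Ideal.mul_mem_mul hb h.mem_right)
  refine h.of_mem h'.mem_left h.mem_right ?_ (Ideal.subset_span (by simp))
  obtain ⟨a', ha'⟩ := ha.exists_left_inv
  exact Ideal.mem_span_pair.2 ⟨a', -(a' * b), by linear_combination y * ha'⟩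

theorem RealizesCharacteristicPolyhedron.isMaximalWeight {f x₁ x₂ : R} {δ : ℚ}
    (h : RealizesCharacteristicPolyhedron f x₁ x₂ δ) (hf0 : f ≠ 0) (hf : f ∈ maximalIdeal R) :
    IsMaximalWeight f x₁ x₂ δ (order f) := by
  have hx := h.1
  have := hx.isNoetherianRing
  obtain ⟨hmem, hnot⟩ := order_spec hf0
  have hn : order f ≠ 0 := by
    intro h0
    rw [h0, zero_add, pow_one] at hnot
    exact hnot hf
  rcases h.2 with ⟨⟨y, hy, u, hu, hfu⟩, hproj, hchar⟩ | ⟨hno, rfl⟩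
  · have hδmem : (δ : ℝ) ∈ characteristicPolyhedron f x₂ := hchar ▸ Set.self_mem_Ici
    have hδ : ∀ z, IsParameters z x₂ → (δ : ℝ) ∈ projectedPolyhedron f x₂ z := by
      intro z hz
      rw [characteristicPolyhedron, Set.mem_iInter₂] at hδmem
      exact hδmem z hz
    -- The initial form is a power of `y`, so all points of the polyhedron for this `y` exceed `1`.
    have h1 : (1 : ℝ) < δ := hy.projectedPolyhedron_subset (hy.mem_initialIdeal_one hfu) (hδ y hy)
    refine ⟨hx, Nat.pos_of_ne_zero hn, h1.le,
      mem_weightGe_of_projectedPolyhedron_eq (by linarith) (hproj.trans hchar),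
      hnot, ?_⟩
    intro z w hz hfz
    obtain ⟨v, hv, hfv⟩ := hz.exists_isUnit_of_mem_initialIdeal h1.le hfz hnot
    have hz' := hy.of_hasInitialPower hz hn hv hfu hfv
    have hfz' := initialIdeal_le_of_mem (hz'.maximalIdeal_le_weightGe h1.le hz.mem_right) _ hfz
    exact lt_irrefl (δ : ℝ) (hz'.projectedPolyhedron_subset hfz' (hδ z hz'))
  · refine ⟨hx, Nat.pos_of_ne_zero hn, by simp, ?_, hnot, ?_⟩
    · simpa using hx.pow_le_weightGe le_rfl _ hmem
    · intro z w hz hfz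
      exact hno ⟨z, w, hz, hz.exists_isUnit_of_mem_initialIdeal (by simp) hfz hnot⟩

end CharacteristicPolyhedron

/-! ### A binomial coefficient that survives in the residue field. -/

section Choose

/-- Lucas' theorem, removing one factor `p` at a time. -/
theorem choose_pow_mul_modEq (p e m : ℕ) [Fact p.Prime] :
    (p ^ e * m).choose (p ^ e) ≡ m [MOD p] := by
  induction e with
  | zero => simpa using Nat.ModEq.refl m
  | succ e ih =>
    have hp : 0 < p := (Fact.out : p.Prime).pos
    refine (Choose.choose_modEq_choose_mod_mul_choose_div_nat).trans ?_
    have h1 : p ^ (e + 1) * m = p * (p ^ e * m) := by ring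
    have h2 : p ^ (e + 1) = p * p ^ e := by ring
    rw [h1, h2, Nat.mul_mod_right, Nat.mul_mod_right, Nat.mul_div_cancel_left _ hp,
      Nat.mul_div_cancel_left _ hp]
    simpa using ih

theorem exists_choose_expChar_pow_ne_zero (K : Type u) [Field K] (p : ℕ) [hp : ExpChar K p]
    {n : ℕ} (hn : n ≠ 0) : ∃ e, p ^ e ≤ n ∧ ((n.choose (p ^ e) : ℕ) : K) ≠ 0 := by
  cases hp with
  | zero => exact ⟨0, by simp; omega, by simpa using hn⟩
  | prime hprime =>
    have : Fact p.Prime := ⟨hprime⟩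
    obtain ⟨e, m, hm, rfl⟩ := Nat.exists_eq_pow_mul_and_not_dvd hn p hprime.ne_one
    refine ⟨e, Nat.le_mul_of_pos_right _ (Nat.pos_of_ne_zero (by rintro rfl; simp at hm)), ?_⟩
    rw [Ne, CharP.cast_eq_zero_iff K p, (choose_pow_mul_modEq p e m).dvd_iff dvd_rfl]
    exact hm

end Choose

/-! ### Weighted initial forms for an integral weight. -/

section Coefficients

variable {R : Type u} [CommRing R]

theorem weightGe_mul_weightGt_le (x y : R) (d s t : ℝ) :
    weightGe x y d s * weightGt x y d t ≤ weightGt x y d (s + t) := by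
  rw [weightGe, weightGt, monomialIdeal, monomialIdeal, Ideal.span_mul_span', Ideal.span_le]
  rintro _ ⟨_, ⟨⟨i, j⟩, hij, rfl⟩, _, ⟨⟨k, l⟩, hkl, rfl⟩, rfl⟩
  have : x ^ (i + k) * y ^ (j + l) ∈ weightGt x y d (s + t) := by
    refine monomial_mem ?_
    simp only [Set.mem_ofPred_eq] at hij hkl ⊢
    push_cast
    linarith
  have heq : x ^ i * y ^ j * (x ^ k * y ^ l) = x ^ (i + k) * y ^ (j + l) := by
    simp only [pow_add]
    ring
  rw [← heq] at this
  exact this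

theorem pow_sub_pow_mem_weightGt {x y a b : R} {d s : ℝ} (ha : a ∈ weightGe x y d s)
    (hb : b ∈ weightGe x y d s) (hab : a - b ∈ weightGt x y d s) (n : ℕ) :
    a ^ n - b ^ n ∈ weightGt x y d (s * n) := by
  induction n with
  | zero => simp
  | succ n ih =>
    have heq : a ^ (n + 1) - b ^ (n + 1) = a ^ n * (a - b) + b * (a ^ n - b ^ n) := by ring
    rw [heq]
    have hs : s * ((n + 1 : ℕ) : ℝ) = s * n + s := by push_cast; ring
    rw [hs]
    refine add_mem (weightGe_mul_weightGt_le _ _ _ _ _ (Ideal.mul_mem_mul ?_ hab)) ?_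
    · rw [mul_comm]
      exact pow_mem_weightGe ha n
    · rw [add_comm]
      exact weightGe_mul_weightGt_le _ _ _ _ _ (Ideal.mul_mem_mul hb ih)

theorem exists_coeff_of_mem_weightGe {x y f : R} {N n : ℕ} (hN : N ≠ 0)
    (hf : f ∈ weightGe x y N (N * n)) :
    ∃ a : ℕ → R, f - ∑ i ∈ Finset.range (n + 1), a i * (x ^ i * y ^ (N * (n - i))) ∈
      weightGt x y N (N * n) := by
  classical
  rw [weightGe, monomialIdeal, Ideal.span] at hf
  induction hf using Submodule.span_induction with
  | zero => exact ⟨0, by simp⟩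
  | add g h _ _ hg hh =>
    obtain ⟨a, ha⟩ := hg
    obtain ⟨b, hb⟩ := hh
    refine ⟨a + b, ?_⟩
    convert add_mem ha hb using 1
    simp only [Pi.add_apply, add_mul, Finset.sum_add_distrib]
    ring
  | smul r g _ hg =>
    obtain ⟨a, ha⟩ := hg
    refine ⟨fun i => r * a i, ?_⟩
    convert Ideal.mul_mem_left _ r ha using 1
    simp only [mul_sub, Finset.mul_sum, smul_eq_mul, mul_assoc]
  | mem g hg =>
    obtain ⟨⟨i, j⟩, hij, rfl⟩ := hg
    have hij : (N : ℝ) * n ≤ N * i + j := hij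
    have hij' : N * n ≤ N * i + j := by exact_mod_cast hij
    rcases hij'.lt_or_eq with hlt | heq
    · refine ⟨0, ?_⟩
      simp only [Pi.zero_apply, zero_mul, Finset.sum_const_zero, sub_zero]
      refine monomial_mem ?_
      have : (N : ℝ) * n < N * i + j := by exact_mod_cast hlt
      exact this
    · have hi : i ≤ n := by
        refine Nat.le_of_mul_le_mul_left ?_ (Nat.pos_of_ne_zero hN)
        omega
      have hj : N * (n - i) = j := by
        rw [Nat.mul_sub]
        omega
      refine ⟨Pi.single i 1, ?_⟩
      rw [Finset.sum_eq_single i]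
      · simp [hj]
      · intro k _ hk
        simp [hk]
      · intro hni
        exact absurd (Finset.mem_range.2 (by omega)) hni

theorem IsParameters.add_mul_pow [IsLocalRing R] {x y : R} (h : IsParameters x y)
    (b : R) {N : ℕ} (hN : N ≠ 0) :
    IsParameters (x + b * y ^ N) y := by
  refine h.of_mem (add_mem h.mem_left
    (Ideal.mul_mem_left _ _ (Ideal.pow_mem_of_mem _ h.mem_right _ (Nat.pos_of_ne_zero hN))))
    h.mem_right ?_ (Ideal.subset_span (by simp))
  refine Ideal.mem_span_pair.2 ⟨1, -b * y ^ (N - 1), ?_⟩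
  have : y ^ N = y ^ (N - 1) * y := by rw [← pow_succ]; congr; omega
  rw [this]
  ring

/-- The coefficients of a weighted form are determined modulo the maximal ideal: all other monomials
of the same weight, and all heavier ones, lie in `(x ^ (i + 1), y ^ (N * (n - i) + 1))`. -/
theorem IsParameters.coeff_mem_of_sum_mem [IsLocalRing R] {x y : R} (h : IsParameters x y)
    {N n : ℕ} (hN : N ≠ 0) {a : ℕ → R}
    (ha : ∑ i ∈ Finset.range (n + 1), a i * (x ^ i * y ^ (N * (n - i))) ∈
      weightGt x y N (N * n)) {i : ℕ} (hi : i ≤ n) : a i ∈ maximalIdeal R := by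
  classical
  have hi' : i ∈ Finset.range (n + 1) := Finset.mem_range.2 (by omega)
  rw [← Finset.add_sum_erase _ _ hi'] at ha
  refine h.coeff_mem (m := i) (n := N * (n - i)) ?_
  have hle : weightGt x y N (N * n) ≤ Ideal.span {x ^ (i + 1), y ^ (N * (n - i) + 1)} := by
    refine monomialIdeal_le_span fun k l hkl => ?_
    have hkl : (N : ℝ) * n < N * k + l := hkl
    have hkl' : N * n < N * k + l := by exact_mod_cast hkl
    by_contra! hcon
    have h1 := Nat.mul_le_mul_left N hcon.1
    have h2 : N * i ≤ N * n := Nat.mul_le_mul_left N hi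
    have h3 := hcon.2
    rw [Nat.mul_sub] at h3
    omega
  refine ((Ideal.span {x ^ (i + 1), y ^ (N * (n - i) + 1)}).add_mem_iff_left
    (Ideal.sum_mem _ fun k hk => ?_)).1 (hle ha)
  rw [Finset.mem_erase, Finset.mem_range] at hk
  refine Ideal.mul_mem_left _ _ ?_
  rcases lt_or_gt_of_ne hk.1 with hlt | hgt
  · have hlt' : N * (n - i) + 1 ≤ N * (n - k) :=
      Nat.mul_lt_mul_of_pos_left (by omega) (Nat.pos_of_ne_zero hN)
    exact Ideal.mul_mem_left _ _ (Ideal.mem_of_dvd _ (pow_dvd_pow y hlt')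
      (Ideal.subset_span (by simp)))
  · exact Ideal.mul_mem_right _ _ (Ideal.mem_of_dvd _ (pow_dvd_pow x hgt)
      (Ideal.subset_span (by simp)))

theorem mem_monomialIdeal_of_map {S : Type v} [CommRing S] [Algebra R S]
    [Module.FaithfullyFlat R S] {x y f : R} {G : Set (ℕ × ℕ)}
    (h : algebraMap R S f ∈ monomialIdeal (algebraMap R S x) (algebraMap R S y) G) :
    f ∈ monomialIdeal x y G := by
  rw [← map_monomialIdeal] at h
  have := Ideal.comap_map_eq_self_of_faithfullyFlat (B := S) (monomialIdeal x y G)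
  rw [← this]
  exact h

end Coefficients

/-! ### Descent of an `n`-th power initial form along a flat local extension. -/

section Descent

variable {R : Type u} {S : Type v} [CommRing R] [CommRing S] [IsLocalRing R] [IsLocalRing S]
  [Algebra R S]

/-- Every element of the residue field of `S` which has a `p ^ e`-th power in the residue field
of `R`, where `p` is the characteristic exponent, lies in the residue field of `R`. -/
def ResidueRootClosed (R : Type u) (S : Type v) [CommRing R] [CommRing S] [IsLocalRing R]
    [IsLocalRing S] [Algebra R S] : Prop :=
  ∀ (p e : ℕ) [ExpChar (ResidueField R) p] (β : S) (a : R),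
    β ^ p ^ e - algebraMap R S a ∈ maximalIdeal S → ∃ b : R, β - algebraMap R S b ∈ maximalIdeal S

/-- Expand the `n`-th power and compare with the coefficients `a i` of `f` over `R`: `a n ≡ u` and
`a (n - q) ≡ u * n.choose q * β ^ q`. For a power `q` of the characteristic exponent with `n.choose
q` invertible, `β ^ q` is thus residually defined over `R`. -/
theorem ResidueRootClosed.exists_sub_mem (hres : ResidueRootClosed R S)
    (hmap : (maximalIdeal R).map (algebraMap R S) = maximalIdeal S) {x₁ x₂ f : R}
    (hS : IsParameters (algebraMap R S x₁) (algebraMap R S x₂)) {N n : ℕ} (hN : N ≠ 0)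
    (hn : n ≠ 0) (hf : f ∈ weightGe x₁ x₂ N (N * n)) {u β : S} (hu : IsUnit u)
    (hfu : algebraMap R S f - u * (algebraMap R S x₁ + β * algebraMap R S x₂ ^ N) ^ n ∈
      weightGt (algebraMap R S x₁) (algebraMap R S x₂) N (N * n)) :
    ∃ b : R, β - algebraMap R S b ∈ maximalIdeal S := by
  obtain ⟨a, ha⟩ := exists_coeff_of_mem_weightGe hN hf
  have ha' := Ideal.mem_map_of_mem (algebraMap R S) ha
  rw [weightGt, map_monomialIdeal] at ha'
  have hsum : ∑ i ∈ Finset.range (n + 1),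
      (algebraMap R S (a i) - u * n.choose i * β ^ (n - i)) *
        (algebraMap R S x₁ ^ i * algebraMap R S x₂ ^ (N * (n - i))) ∈
      weightGt (algebraMap R S x₁) (algebraMap R S x₂) N (N * n) := by
    convert sub_mem hfu ha' using 1
    rw [map_sub, map_sum, add_pow, Finset.mul_sum, sub_sub_sub_cancel_left,
      ← Finset.sum_sub_distrib]
    refine Finset.sum_congr rfl fun i _ => ?_
    rw [map_mul, map_mul, map_pow, map_pow, mul_pow, ← pow_mul]
    ring
  have hcoeff := fun {i : ℕ} (hi : i ≤ n) => hS.coeff_mem_of_sum_mem hN hsum hi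
  have hlead : algebraMap R S (a n) - u ∈ maximalIdeal S := by
    simpa using hcoeff le_rfl
  have hmem : ∀ r : R, r ∈ maximalIdeal R → algebraMap R S r ∈ maximalIdeal S := fun r hr =>
    hmap ▸ Ideal.mem_map_of_mem _ hr
  have han : IsUnit (a n) := by
    by_contra hcon
    have := sub_mem (hmem _ ((mem_maximalIdeal _).2 hcon)) hlead
    rw [sub_sub_cancel] at this
    exact (mem_maximalIdeal _).1 this hu
  obtain ⟨p, hp⟩ := ExpChar.exists (ResidueField R)
  obtain ⟨e, hle, hne⟩ := exists_choose_expChar_pow_ne_zero (ResidueField R) p hn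
  have hchoose : IsUnit ((n.choose (p ^ e) : ℕ) : R) := by
    rw [← map_natCast (residue R)] at hne
    by_contra hcon
    exact hne ((residue_eq_zero_iff _).2 ((mem_maximalIdeal _).2 hcon))
  obtain ⟨c, hc⟩ := (han.mul hchoose).exists_left_inv
  refine hres p e β (c * a (n - p ^ e)) ?_
  have h1 := hcoeff (Nat.sub_le n (p ^ e))
  rw [Nat.choose_symm hle, Nat.sub_sub_self hle] at h1
  have hc' : algebraMap R S c * (algebraMap R S (a n) * (n.choose (p ^ e) : S)) = 1 := by
    rw [← map_natCast (algebraMap R S), ← map_mul, ← map_mul, hc, map_one]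
  have key : β ^ p ^ e - algebraMap R S (c * a (n - p ^ e)) =
      (algebraMap R S c * (n.choose (p ^ e) : S) * β ^ p ^ e) * (algebraMap R S (a n) - u) -
      algebraMap R S c * (algebraMap R S (a (n - p ^ e)) -
        u * (n.choose (p ^ e) : S) * β ^ p ^ e) := by
    rw [map_mul]
    linear_combination (-β ^ p ^ e) * hc'
  rw [key]
  exact sub_mem (Ideal.mul_mem_left _ _ hlead) (Ideal.mul_mem_left _ _ h1)

variable [Module.FaithfullyFlat R S]

theorem IsMaximalWeight.not_mem_weightGt_of_isUnit {f x₁ x₂ : R} {d : ℝ} {n : ℕ}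
    (h : IsMaximalWeight f x₁ x₂ d n) (hres : ResidueRootClosed R S)
    (hmap : (maximalIdeal R).map (algebraMap R S) = maximalIdeal S)
    (hS : IsParameters (algebraMap R S x₁) (algebraMap R S x₂)) {u α γ : S} (hu : IsUnit u)
    (hα : IsUnit α) :
    algebraMap R S f - u * (α * algebraMap R S x₁ + γ * algebraMap R S x₂ ^ ⌈d⌉₊) ^ n ∉
      weightGt (algebraMap R S x₁) (algebraMap R S x₂) d (d * n) := by
  intro hmem
  set N := ⌈d⌉₊ with hNdef
  have hdN : d ≤ N := Nat.le_ceil d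
  have hN : N ≠ 0 := by
    intro h0
    rw [h0] at hdN
    have := h.one_le
    norm_num at hdN
    linarith
  set X₁ := algebraMap R S x₁ with hX₁
  set X₂ := algebraMap R S x₂ with hX₂
  obtain ⟨α', hα'⟩ := hα.exists_left_inv
  set β := α' * γ with hβ
  have hpow : u * (α * X₁ + γ * X₂ ^ N) ^ n = u * α ^ n * (X₁ + β * X₂ ^ N) ^ n := by
    rw [mul_assoc, ← mul_pow]
    congr 2
    linear_combination (-γ * X₂ ^ N) * hα'
  rw [hpow] at hmem
  have hunit : IsUnit (u * α ^ n) := hu.mul (hα.pow n)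
  -- If `d < N`, the term `β * x₂ ^ N` has weight above `d` and can be dropped; if `d = N`, `β` is
  -- replaced by a residually equal element of `R`.
  obtain ⟨b, hb⟩ : ∃ b : R, (β - algebraMap R S b) * X₂ ^ N ∈ weightGt X₁ X₂ d d := by
    rcases hdN.lt_or_eq with hlt | heq
    · exact ⟨0, Ideal.mul_mem_left _ _ (weightGe_le_weightGt hlt
        (right_pow_mem_weightGe _ _ le_rfl))⟩
    · have hf := h.mem
      rw [heq] at hf hmem
      obtain ⟨b, hb⟩ := hres.exists_sub_mem hmap hS hN h.pos.ne' hf hunit hmem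
      refine ⟨b, weightGe_le_weightGt (t := 1 + d) (by linarith) ?_⟩
      exact mul_mem_weightGe (hS.maximalIdeal_le_weightGe h.one_le hb)
        (right_pow_mem_weightGe _ _ heq.le)
  have hin : ∀ c : S, X₁ + c * X₂ ^ N ∈ weightGe X₁ X₂ d d := fun c =>
    add_mem (left_mem_weightGe _ _ _) (Ideal.mul_mem_left _ _ (right_pow_mem_weightGe _ _ hdN))
  have hdiff := pow_sub_pow_mem_weightGt (hin β) (hin (algebraMap R S b))
    (by convert hb using 1; ring) n
  have hmem' : algebraMap R S f - u * α ^ n * (X₁ + algebraMap R S b * X₂ ^ N) ^ n ∈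
      weightGt X₁ X₂ d (d * n) := by
    convert add_mem hmem (Ideal.mul_mem_left _ (u * α ^ n) hdiff) using 1
    ring
  set y := x₁ + b * x₂ ^ N with hy
  have hyS : algebraMap R S y = X₁ + algebraMap R S b * X₂ ^ N := by
    rw [hy, map_add, map_mul, map_pow]
  have hyx : IsParameters y x₂ := h.isParameters.add_mul_pow b hN
  have hX₁y : X₁ ∈ weightGe (algebraMap R S y) X₂ d d := by
    have : X₁ = algebraMap R S y - algebraMap R S b * X₂ ^ N := by rw [hyS]; ring
    rw [this]
    exact sub_mem (left_mem_weightGe _ _ _)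
      (Ideal.mul_mem_left _ _ (right_pow_mem_weightGe _ _ hdN))
  have hX₂y : X₂ ∈ weightGe (algebraMap R S y) X₂ d 1 := by
    simpa using right_pow_mem_weightGe (algebraMap R S y) X₂ (d := d) (s := 1) (n := 1) (by simp)
  refine h.not_mem_initialIdeal y x₂ hyx (mem_monomialIdeal_of_map (S := S) ?_)
  change _ ∈ initialIdeal (algebraMap R S y) X₂ d n
  rw [initialIdeal_eq, ← sub_add_cancel (algebraMap R S f) (u * α ^ n * algebraMap R S y ^ n)]
  refine add_mem (Ideal.mem_sup_right (weightGt_le_of_mem hX₁y hX₂y _ ?_))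
    (Ideal.mem_sup_left (Ideal.mul_mem_left _ _ (Ideal.subset_span rfl)))
  rw [hyS]
  exact hmem'

theorem IsMaximalWeight.swap {f x₁ x₂ : R} {n : ℕ} (h : IsMaximalWeight f x₁ x₂ 1 n) :
    IsMaximalWeight f x₂ x₁ 1 n where
  isParameters := h.isParameters.symm
  pos := h.pos
  one_le := h.one_le
  mem := weightGe_le_of_mem (h.isParameters.symm.maximalIdeal_le_weightGe le_rfl
    h.isParameters.mem_left) (left_mem_weightGe _ _ _) _ h.mem
  not_mem_pow := h.not_mem_pow
  not_mem_initialIdeal := h.not_mem_initialIdeal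

theorem IsMaximalWeight.map {f x₁ x₂ : R} {d : ℝ} {n : ℕ}
    (h : IsMaximalWeight f x₁ x₂ d n) (hres : ResidueRootClosed R S)
    (hmap : (maximalIdeal R).map (algebraMap R S) = maximalIdeal S)
    (hS : IsParameters (algebraMap R S x₁) (algebraMap R S x₂)) :
    IsMaximalWeight (algebraMap R S f) (algebraMap R S x₁) (algebraMap R S x₂) d n := by
  have hF : algebraMap R S f ∈
      weightGe (algebraMap R S x₁) (algebraMap R S x₂) d (d * n) := by
    have := Ideal.mem_map_of_mem (algebraMap R S) h.mem
    rwa [weightGe, map_monomialIdeal] at this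
  have hFn : algebraMap R S f ∉ maximalIdeal S ^ (n + 1) := by
    intro hmem
    rw [← hmap, ← Ideal.map_pow] at hmem
    refine h.not_mem_pow ?_
    rw [← Ideal.comap_map_eq_self_of_faithfullyFlat (B := S) (maximalIdeal R ^ (n + 1))]
    exact hmem
  refine ⟨hS, h.pos, h.one_le, hF, hFn, ?_⟩
  intro y z hyz hmem
  have hy := hS.mem_span_of_mem_weightGe hyz h.pos hF (initialIdeal_le_weightGe _ _ _ _ hmem) hFn
  have hyw := span_pair_pow_le_weightGe _ _ (Nat.le_ceil d) hy
  rw [initialIdeal_eq] at hmem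
  obtain ⟨_, hu, s, hs, hus⟩ := Submodule.mem_sup.1 hmem
  obtain ⟨u, rfl⟩ := Ideal.mem_span_singleton'.1 hu
  replace hs := weightGt_le_of_mem hyw (hS.maximalIdeal_le_weightGe h.one_le hyz.mem_right) _ hs
  -- For a nonunit `u` all of `f` would have weight above `d * n`, already over `R`, contradicting
  -- maximality for `(x₁, x₂)`.
  have hunit : IsUnit u := by
    by_contra hu'
    refine h.not_mem_initialIdeal x₁ x₂ h.isParameters ?_
    rw [initialIdeal_eq]
    refine Ideal.mem_sup_right (mem_monomialIdeal_of_map (S := S) ?_)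
    rw [← hus]
    refine add_mem (weightGe_le_weightGt (t := 1 + n * d) (by linarith) ?_) hs
    exact mul_mem_weightGe (hS.maximalIdeal_le_weightGe h.one_le ((mem_maximalIdeal _).2 hu'))
      (pow_mem_weightGe hyw n)
  obtain ⟨α, γ, rfl⟩ := Ideal.mem_span_pair.1 hy
  rw [← eq_sub_iff_add_eq'] at hus
  rw [hus] at hs
  by_cases hα : IsUnit α
  · exact h.not_mem_weightGt_of_isUnit hres hmap hS hunit hα hs
  -- If `α` is not a unit, `y ∉ 𝔪 ^ 2` forces `⌈d⌉₊ = 1` and `γ` a unit. Then `d = 1`, and the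
  -- parameters can be exchanged.
  have hαm := Ideal.mul_mem_mul ((mem_maximalIdeal _).2 hα) hS.mem_left
  rw [← pow_two] at hαm
  have hN : ⌈d⌉₊ = 1 := by
    by_contra hne
    have h1 : 1 ≤ ⌈d⌉₊ := Nat.one_le_ceil_iff.2 (by linarith [h.one_le])
    refine hyz.not_mem_sq (add_mem hαm (Ideal.mul_mem_left _ _ ?_))
    exact Ideal.pow_le_pow_right (by omega) (Ideal.pow_mem_pow hS.mem_right _)
  have hd : d = 1 := le_antisymm (by simpa [hN] using Nat.le_ceil d) h.one_le
  have hγ : IsUnit γ := by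
    by_contra hγ
    refine hyz.not_mem_sq (add_mem hαm ?_)
    rw [hN, pow_one, pow_two]
    exact Ideal.mul_mem_mul ((mem_maximalIdeal _).2 hγ) hS.mem_right
  subst hd
  refine h.swap.not_mem_weightGt_of_isUnit hres hmap hS.symm (γ := α) hunit hγ ?_
  have := weightGt_le_of_mem (hS.symm.maximalIdeal_le_weightGe le_rfl hS.mem_left)
    (left_mem_weightGe _ _ _) _ hs
  simpa [hN, add_comm] using this

end Descent

/-! ### Separable base change: regularity and the residue field extension. -/

section BaseChange

variable {k : Type u} {O : Type u} [Field k] [CommRing O] [Algebra k O]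
  {k' : Type v} [Field k'] [Algebra k k']

theorem isNoetherianRing_tensorProduct [Algebra.EssFiniteType k O] :
    IsNoetherianRing (O ⊗[k] k') := by
  have := Algebra.EssFiniteType.isNoetherianRing k' (k' ⊗[k] O)
  exact isNoetherianRing_of_ringEquiv _ (Algebra.TensorProduct.comm k k' O).toRingEquiv

variable [IsLocalRing O]

variable (k O k') in
/-- The base change to `k'` of the residue map of `O`. -/
noncomputable def residueBaseChange : O ⊗[k] k' →ₐ[k] ResidueField O ⊗[k] k' :=
  Algebra.TensorProduct.map (IsScalarTower.toAlgHom k O (ResidueField O)) (AlgHom.id k k')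

theorem residueBaseChange_algebraMap (a : O) :
    residueBaseChange k O k' (algebraMap O (O ⊗[k] k') a) = residue O a ⊗ₜ 1 := by
  rw [Algebra.TensorProduct.algebraMap_apply, residueBaseChange, Algebra.TensorProduct.map_tmul]
  simp

theorem residueBaseChange_eq_zero_iff {a : O ⊗[k] k'} : residueBaseChange k O k' a = 0 ↔
    a ∈ (maximalIdeal O).map (algebraMap O (O ⊗[k] k')) := by
  have h := Algebra.TensorProduct.rTensor_ker (R := k) (C := k')
    (IsScalarTower.toAlgHom k O (ResidueField O)) residue_surjective
  have hker : RingHom.ker (IsScalarTower.toAlgHom k O (ResidueField O)) = maximalIdeal O :=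
    ker_residue
  rw [hker] at h
  have := (SetLike.ext_iff.1 h a)
  rw [RingHom.mem_ker] at this
  exact this

/-- The map `φ ⊗ k'` is linear over `K ⊗ k'`, so applying it to the equation over `L` gives one over
`K`. -/
theorem apply_one_mul_eq {K L : Type u} [Field K] [Field L] [Algebra k K] [Algebra K L]
    [Algebra k L] [IsScalarTower k K L] (φ : L →ₗ[K] K) {a b : K ⊗[k] k'} {d : L}
    (h : Algebra.TensorProduct.map (IsScalarTower.toAlgHom k K L) (AlgHom.id k k') a =
      (d ⊗ₜ[k] (1 : k')) *
        Algebra.TensorProduct.map (IsScalarTower.toAlgHom k K L) (AlgHom.id k k') b) :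
    (φ 1 ⊗ₜ[k] (1 : k')) * a = (φ d ⊗ₜ[k] (1 : k')) * b := by
  have key : ∀ (z : L) (c : K ⊗[k] k'), LinearMap.rTensor k' (φ.restrictScalars k)
      ((z ⊗ₜ[k] (1 : k')) *
        Algebra.TensorProduct.map (IsScalarTower.toAlgHom k K L) (AlgHom.id k k') c) =
      (φ z ⊗ₜ[k] (1 : k')) * c := by
    intro z c
    induction c using TensorProduct.induction_on with
    | zero => simp
    | add c d hc hd => rw [map_add, mul_add, map_add, hc, hd, mul_add]
    | tmul c t =>
      simp only [Algebra.TensorProduct.map_tmul, Algebra.TensorProduct.tmul_mul_tmul, one_mul,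
        LinearMap.rTensor_tmul, LinearMap.coe_restrictScalars, IsScalarTower.coe_toAlgHom',
        AlgHom.coe_id, id_eq]
      rw [mul_comm z, ← Algebra.smul_def, map_smul, smul_eq_mul, mul_comm]
  rw [← key, ← key, ← h, ← Algebra.TensorProduct.one_def, one_mul]

/-- If `k'` is separable over `k`, an equation `a ^ q = c * b ^ q` in `K ⊗ k'`, where `q` is a
power of the characteristic exponent, comes from an equation `a = e * b` with `e ∈ K`. -/
theorem IsSeparableExtension.exists_eq_mul (hsep : IsSeparableExtension k k') {K : Type u}
    [Field K] [Algebra k K] (p n : ℕ) [ExpChar K p] {a b : K ⊗[k] k'} {c : K}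
    (h : a ^ p ^ n = (c ⊗ₜ[k] (1 : k')) * b ^ p ^ n) :
    ∃ e : K, a = (e ⊗ₜ[k] (1 : k')) * b := by
  let L := AlgebraicClosure K
  have : IsReduced (L ⊗[k] k') := hsep L
  have : ExpChar L p := expChar_of_injective_algebraMap (algebraMap K L).injective p
  have : ExpChar (L ⊗[k] k') p := expChar_of_injective_algebraMap
    (algebraMap L (L ⊗[k] k')).injective p
  obtain ⟨d, hd⟩ := IsAlgClosed.exists_pow_nat_eq (algebraMap K L c)
    (pow_pos (expChar_pos K p) n)
  obtain ⟨φ, hφ⟩ := LinearMap.exists_leftInverse_of_injective (Algebra.linearMap K L)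
    (LinearMap.ker_eq_bot.2 (algebraMap K L).injective)
  have hφ1 : φ 1 = 1 := by
    have := LinearMap.congr_fun hφ 1
    simpa using this
  set ι := Algebra.TensorProduct.map (IsScalarTower.toAlgHom k K L) (AlgHom.id k k')
  -- Over the algebraic closure `c = d ^ q`, so by additivity of Frobenius `a - d * b` is nilpotent,
  -- hence zero. A `K`-linear retraction `φ` with `φ 1 = 1` then gives `e = φ d`.
  have hzero : (ι a - (d ⊗ₜ[k] (1 : k')) * ι b) ^ p ^ n = 0 := by
    have h1 := congrArg ι h
    rw [map_mul, map_pow, map_pow, Algebra.TensorProduct.map_tmul] at h1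
    rw [sub_pow_expChar_pow, h1, mul_pow, Algebra.TensorProduct.tmul_pow, hd, one_pow]
    simp
  refine ⟨φ d, ?_⟩
  have := apply_one_mul_eq φ (sub_eq_zero.1 (IsReduced.eq_zero _ ⟨_, hzero⟩))
  rwa [hφ1, ← Algebra.TensorProduct.one_def, one_mul] at this

variable {P : Ideal (O ⊗[k] k')} [P.IsPrime]

/-- The fibre ring `ResidueField O ⊗ k'` is reduced, so the extended ideal is radical, and
localizing a radical ideal at a minimal prime over it gives the maximal ideal. -/
theorem map_maximalIdeal_eq (hsep : IsSeparableExtension k k')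
    (hP : P ∈ ((maximalIdeal O).map (algebraMap O (O ⊗[k] k'))).minimalPrimes) :
    (maximalIdeal O).map (algebraMap O (Localization.AtPrime P)) =
      maximalIdeal (Localization.AtPrime P) := by
  have : IsReduced (ResidueField O ⊗[k] k') := hsep (ResidueField O)
  set I := (maximalIdeal O).map (algebraMap O (O ⊗[k] k')) with hI
  have hmap : (maximalIdeal O).map (algebraMap O (Localization.AtPrime P)) =
      I.map (algebraMap (O ⊗[k] k') (Localization.AtPrime P)) := by
    rw [hI, Ideal.map_map, ← IsScalarTower.algebraMap_eq]
  have hrad : I.IsRadical := by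
    intro a ha
    obtain ⟨n, hn⟩ := ha
    rw [← residueBaseChange_eq_zero_iff, map_pow] at hn
    rw [← residueBaseChange_eq_zero_iff]
    exact IsReduced.eq_zero _ ⟨n, hn⟩
  rw [hmap, ← IsLocalization.AtPrime.map_eq_maximalIdeal P (Localization.AtPrime P)]
  refine le_antisymm (Ideal.map_mono hP.1.2) (Ideal.map_le_iff_le_comap.2 fun a ha => ?_)
  have hmem := Ideal.mem_map_of_mem (algebraMap (O ⊗[k] k') (Localization.AtPrime P)) ha
  rw [← IsLocalization.AtPrime.radical_map_of_mem_minimalPrimes (Localization.AtPrime P) P I hP]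
    at hmem
  obtain ⟨n, hn⟩ := hmem
  rw [← map_pow, IsLocalization.algebraMap_mem_map_algebraMap_iff P.primeCompl] at hn
  obtain ⟨t, ht, htn⟩ := hn
  rw [Ideal.mem_comap, IsLocalization.algebraMap_mem_map_algebraMap_iff P.primeCompl]
  refine ⟨t, ht, hrad ⟨n + 1, ?_⟩⟩
  have heq : (t * a) ^ (n + 1) = t ^ n * a * (t * a ^ n) := by ring
  rw [heq]
  exact Ideal.mul_mem_left _ _ htn

theorem residueRootClosed_localization (hsep : IsSeparableExtension k k')
    (hP : P ∈ ((maximalIdeal O).map (algebraMap O (O ⊗[k] k'))).minimalPrimes) :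
    ResidueRootClosed O (Localization.AtPrime P) := by
  intro p n _ β a hβ
  have hmap : (maximalIdeal O).map (algebraMap O (Localization.AtPrime P)) =
      ((maximalIdeal O).map (algebraMap O (O ⊗[k] k'))).map
        (algebraMap (O ⊗[k] k') (Localization.AtPrime P)) := by
    rw [Ideal.map_map, ← IsScalarTower.algebraMap_eq]
  obtain ⟨⟨x, s⟩, hxs⟩ := IsLocalization.surj P.primeCompl β
  simp only at hxs
  have h1 : algebraMap (O ⊗[k] k') (Localization.AtPrime P)
      (x ^ p ^ n - algebraMap O (O ⊗[k] k') a * s ^ p ^ n) ∈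
        maximalIdeal (Localization.AtPrime P) := by
    convert Ideal.mul_mem_left _ (algebraMap (O ⊗[k] k') (Localization.AtPrime P) s ^ p ^ n) hβ using 1
    rw [map_sub, map_mul, map_pow, map_pow, ← hxs, ← IsScalarTower.algebraMap_apply]
    ring
  rw [← map_maximalIdeal_eq hsep hP, hmap,
    IsLocalization.algebraMap_mem_map_algebraMap_iff P.primeCompl] at h1
  obtain ⟨t, ht, hts⟩ := h1
  have h2 : (residueBaseChange k O k' (t * x)) ^ p ^ n =
      (residue O a ⊗ₜ[k] (1 : k')) * (residueBaseChange k O k' (t * s)) ^ p ^ n := by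
    rw [← residueBaseChange_algebraMap, ← map_pow, ← map_pow, ← map_mul, ← sub_eq_zero, ← map_sub,
      residueBaseChange_eq_zero_iff]
    -- Clearing denominators produced a single factor `t`; multiplying by `t ^ (p ^ n - 1)`
    -- completes it to the power needed for `(t * x) ^ p ^ n`.
    obtain ⟨m, hm⟩ := Nat.exists_eq_succ_of_ne_zero (pow_pos (expChar_pos (ResidueField O) p) n).ne'
    convert Ideal.mul_mem_left _ (t ^ m) hts using 1
    rw [hm, Nat.succ_eq_add_one]
    ring
  obtain ⟨e, he⟩ := hsep.exists_eq_mul p n h2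
  obtain ⟨b, rfl⟩ := residue_surjective e
  refine ⟨b, ?_⟩
  rw [← residueBaseChange_algebraMap, ← map_mul, ← sub_eq_zero, ← map_sub,
    residueBaseChange_eq_zero_iff] at he
  have h3 := Ideal.mem_map_of_mem (algebraMap (O ⊗[k] k') (Localization.AtPrime P)) he
  rw [← hmap, map_maximalIdeal_eq hsep hP] at h3
  have hunit : IsUnit (algebraMap (O ⊗[k] k') (Localization.AtPrime P) (t * s)) :=
    IsLocalization.map_units _ (⟨t, ht⟩ * s : P.primeCompl)
  have h4 : algebraMap (O ⊗[k] k') (Localization.AtPrime P)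
      (t * x - algebraMap O (O ⊗[k] k') b * (t * s)) =
      algebraMap (O ⊗[k] k') (Localization.AtPrime P) (t * s) *
        (β - algebraMap O (Localization.AtPrime P) b) := by
    rw [map_sub, map_mul, map_mul, map_mul, ← hxs, ← IsScalarTower.algebraMap_apply]
    ring
  rw [h4] at h3
  exact (Ideal.unit_mul_mem_iff_mem _ hunit).1 h3

/-- Going-down for the flat extension gives dimension at least two, while the maximal ideal is
generated by two elements. -/
theorem isParameters_localization [Algebra.EssFiniteType k O] (hsep : IsSeparableExtension k k')
    (hP : P ∈ ((maximalIdeal O).map (algebraMap O (O ⊗[k] k'))).minimalPrimes) {x₁ x₂ : O}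
    (hx : IsParameters x₁ x₂) : Module.FaithfullyFlat O (Localization.AtPrime P) ∧
      IsParameters (algebraMap O (Localization.AtPrime P) x₁)
        (algebraMap O (Localization.AtPrime P) x₂) := by
  set S := Localization.AtPrime P
  have := hx.isNoetherianRing
  have hmap : (maximalIdeal O).map (algebraMap O S) = maximalIdeal S := map_maximalIdeal_eq hsep hP
  have : IsNoetherianRing (O ⊗[k] k') := isNoetherianRing_tensorProduct
  have : IsNoetherianRing S := IsLocalization.isNoetherianRing P.primeCompl S inferInstance
  have : Module.Flat (O ⊗[k] k') S := IsLocalization.flat S P.primeCompl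
  have : Module.Flat O S := Module.Flat.trans O (O ⊗[k] k') S
  have hloc : IsLocalHom (algebraMap O S) :=
    ((IsLocalRing.local_hom_TFAE (algebraMap O S)).out 0 2).2 hmap.le
  have hff : Module.FaithfullyFlat O S := Module.FaithfullyFlat.of_flat_of_isLocalHom
  have hspan : Ideal.span {algebraMap O S x₁, algebraMap O S x₂} = maximalIdeal S := by
    rw [← hmap, ← hx.span_eq, Ideal.map_span, Set.image_pair]
  have hcomap : (maximalIdeal S).comap (algebraMap O S) = maximalIdeal O :=
    ((IsLocalRing.local_hom_TFAE (algebraMap O S)).out 0 4).1 hloc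
  have hover : (maximalIdeal S).LiesOver (maximalIdeal O) := ⟨hcomap.symm⟩
  have hheight := Ideal.height_eq_height_add_of_liesOver_of_hasGoingDown
    (maximalIdeal O) (maximalIdeal S)
  rw [hx.maximalIdeal_height] at hheight
  have hge : (2 : WithBot ℕ∞) ≤ ringKrullDim S := by
    rw [← IsLocalRing.maximalIdeal_height_eq_ringKrullDim, hheight]
    exact WithBot.coe_le_coe.2 le_self_add
  have hrank : (maximalIdeal S).spanFinrank ≤ 2 := by
    rw [← hspan]
    exact (Submodule.spanFinrank_span_le_ncard_of_finite (Set.toFinite _)).trans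
      ((Set.ncard_insert_le _ _).trans (by rw [Set.ncard_singleton]))
  have hrank' : ((maximalIdeal S).spanFinrank : WithBot ℕ∞) ≤ 2 := by exact_mod_cast hrank
  exact ⟨hff, IsRegularLocalRing.of_spanFinrank_maximalIdeal_le S (hrank'.trans hge),
    le_antisymm ((ringKrullDim_le_spanFinrank_maximalIdeal S).trans hrank') hge, hspan⟩

end BaseChange

end PlaneCurve

open PlaneCurve in
/-- `O` is the local ring of the regular surface `S` at the closed point `q`, and `f` a local
equation of the curve `C`, whose reduction is singular at `q`. In the second part, `P` runs over
the generic points of the fibre of `Spec (O ⊗ k') → Spec O` over `q`; these are all points over `q`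
if `k'` is algebraic over `k`, and in general the points over `q` whose local ring is again
two-dimensional. -/
theorem theorem3p4 {k : Type u} {O : Type u} [Field k] [CommRing O] [IsRegularLocalRing O]
    [Algebra k O] [Algebra.EssFiniteType k O] (hdim : ringKrullDim O = 2)
    (f : O) (hf0 : f ≠ 0) (hf : f ∈ maximalIdeal O)
    (hsing : ¬ IsRegularLocalRing (O ⧸ (Ideal.span {f}).radical))
    (x₁ x₂ : O) (δ : ℚ) (hx : RealizesCharacteristicPolyhedron f x₁ x₂ δ) :
    ∃ J : Center O,
      (J.x₁ = x₁ ∧ J.x₂ = x₂ ∧ J.a₁ = (order f : ℚ) ∧ J.a₂ = (order f : ℚ) * δ) ∧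
      J.IsUniqueMaximalAdmissible f ∧
      ∀ (k' : Type v) [Field k'] [Algebra k k'], IsSeparableExtension k k' →
        ∀ (P : Ideal (O ⊗[k] k')) [P.IsPrime],
          P ∈ ((maximalIdeal O).map (algebraMap O (O ⊗[k] k'))).minimalPrimes →
          ∃ J' : Center (Localization.AtPrime P),
            (J'.x₁ = algebraMap O (Localization.AtPrime P) x₁ ∧
              J'.x₂ = algebraMap O (Localization.AtPrime P) x₂ ∧
              J'.a₁ = J.a₁ ∧ J'.a₂ = J.a₂) ∧
            J'.IsUniqueMaximalAdmissible (algebraMap O (Localization.AtPrime P) f) := by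
  have h := hx.isMaximalWeight hf0 hf
  have hn : (0 : ℚ) < order f := by exact_mod_cast h.pos
  have hδ : (0 : ℚ) < δ := lt_of_lt_of_le one_pos (by exact_mod_cast h.one_le)
  refine ⟨⟨x₁, x₂, order f, order f * δ, hx.1, hn, mul_pos hn hδ⟩, ⟨rfl, rfl, rfl, rfl⟩,
    h.isUniqueMaximalAdmissible _ rfl rfl rfl rfl, ?_⟩
  intro k' _ _ hsep P _ hP
  obtain ⟨hflat, hpar⟩ := isParameters_localization hsep hP hx.1
  have h' := h.map (residueRootClosed_localization hsep hP) (map_maximalIdeal_eq hsep hP) hpar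
  exact ⟨⟨_, _, order f, order f * δ, hpar, hn, mul_pos hn hδ⟩, ⟨rfl, rfl, rfl, rfl⟩,
    h'.isUniqueMaximalAdmissible _ rfl rfl rfl rfl⟩
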